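/- **Notation.** Let $A=\begin{pmatrix}1&1\\1&0\end{pmatrix}$, $\varphi=\frac{1+\sqrt5}{2}$, $c=(1+\varphi^2)^{-1/2}$, $e_u=c(\varphi,1)^T$, $e_s=c(-1,\varphi)^T$, so $Ae_u=\varphi e_u$ and $Ae_s=-\varphi^{-1}e_s$. Let $E^s=\{v\in\mathbb R^2: A^nv\to0\}$ be the stable space of $A$. For $w=(w_1,w_2)\in\mathbb R^2$ and $h=(h_1,h_2)$ with positive integer entries, $w_2\ge0$ and $|w_1|/|w_2|<h_2/h_1$, the *best ordering* associated with $(w,h)$ is the word $p_1\dots p_{h_1+h_2}$ in $\{1,2\}$ with $p_{n+1}=1$ if $\langle \sum_{i=1}^n e_{p_i}-h,\,w\rangle>0$ and $p_{n+1}=2$ otherwise, where $e_1,e_2$ are the canonical vectors of $\mathbb R^2$. **Construction.** Let $(\epsilon_n)_{n\ge1}$ and $(\delta_n)_{n\ge1}$ be decreasing (in the wide sense) sequences in $]0,\varphi^{-1}]$ with $\delta_n\le\epsilon_n$ and $\sum_n\epsilon_n<\infty$, and let $0<v_1<\epsilon_1$. Consider integers $k_n>2$ with $\varphi^{-k_n}\le\epsilon_n$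 ($n\ge2$), numbers $0<\beta<1$, $t>v_1$ and $\alpha$, and, for $n\ge1$, numbers $u_n,v_n$ ($v_1$ being the given one) and vectors $z_n\in\mathbb Z^2$, such that, with $K_n=\sum_{i=2}^nk_i$, 1. for all $n\ge1$ and all real $s>v_1$, $$A^{K_n}(\beta e_u+s e_s)=z_n+u_ne_u+\bigl(v_n+\varphi^{-K_n}(s-v_1)\bigr)e_s,\qquad 0<v_n<\epsilon_n,\quad 0<u_n\le\delta_nv_n ;$$ 2. $\alpha(1,1)^T=(1,0)^T+\beta e_u+t e_s$; 3. with $w_n=u_ne_u+(v_n+\varphi^{-K_n}(t-v_1))e_s$, for all $n\ge1$ and each row $h$ of $A^{k_{n+1}}$ the best ordering associated with $(w_n,h)$ is defined, that is, $(w_n)_2\ge 0$, $h_1,h_2>0$ and $|(w_n)_1|/|(w_n)_2|<h_2/h_1$. Let $B$ be the ordered Bratteli diagram with one vertex at level $0$, vertices $1,2$ at every level $n\ge1$, one edge from the root to each vertex of level $1$ (so $H(1)=(1,1)^T$), and in which, for $n\ge1$, the initial points of the edges from level $n$ to the vertex $j$ of level $n+1$, in increasing order, form the best ordering associated with $w_n$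 and the $j$-th row of $A^{k_{n+1}}$. Let $H(n)$ be the vector of the numbers of paths from the root to the vertices of level $n$. **Theorem.** Such data exist for every choice of $(\epsilon_n)$, $(\delta_n)$, $v_1$ as above. For all such data: * $B$ is a properly ordered Bratteli diagram (it has a unique maximal and a unique minimal infinite path) whose incidence matrix between levels $n-1$ and $n$ is $M(n)=A^{k_n}$ for all $n\ge2$. Its Vershik map $T$ is a homeomorphism of its path space $X$, and $(X,T)$ is a uniquely ergodic Cantor minimal system of topological finite rank $2$ (that is, it has a Bratteli–Vershik representation with at most two vertices at each level $n\ge1$). * For every $m\ge1$, $\alpha H(m)\notin\mathbb Z^2+E^s$. * $\exp(2i\pi\alpha)$ is an eigenvalue of $(X,T,\mu)$, where $\mu$ is the unique $T$-invariant Borel probability measure: there is a nonzero $f\in L^2(\mu)$ with $f\circ T=\exp(2i\pi\alpha)f$. * $\exp(2i\pi\alpha)$ is not a continuous eigenvalue: there is no nonzero continuous $f:X\to\mathbb C$ with $f\circ T=\exp(2i\pi\alpha)f$. -/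

import Mathlib

open Filter MeasureTheory
open scoped Topology Matrix

/-! ### Topological dynamics -/

/-- A Cantor space: a nonempty compact Hausdorff space with a countable basis of closed and open
sets and without isolated points. -/
def IsCantorSpace (X : Type*) [TopologicalSpace X] : Prop :=
  Nonempty X ∧ CompactSpace X ∧ T2Space X ∧
    (∃ b : Set (Set X), b.Countable ∧ TopologicalSpace.IsTopologicalBasis b ∧
      ∀ s ∈ b, IsClopen s) ∧
    ∀ x : X, ¬ IsOpen ({x} : Set X)

/-- Minimality: every (two-sided) orbit is dense. -/
def IsMinimalHomeo {X : Type*} [TopologicalSpace X] (T : X ≃ₜ X) : Prop :=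
  ∀ x : X, Dense (Set.range fun n : ℤ => (T ^ n) x)

/-- Exactly one invariant Borel probability measure. -/
def IsUniquelyErgodic {X : Type*} [TopologicalSpace X] [MeasurableSpace X] (T : X ≃ₜ X) : Prop :=
  ∃! μ : Measure X, IsProbabilityMeasure μ ∧ MeasurePreserving T μ μ

/-- `lam` is a continuous eigenvalue of `(X, T)`. -/
def IsContinuousEigenvalue {X : Type*} [TopologicalSpace X] (T : X ≃ₜ X) (lam : ℂ) : Prop :=
  ∃ f : X → ℂ, Continuous f ∧ f ≠ 0 ∧ ∀ x, f (T x) = lam * f x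

/-- `lam` is an eigenvalue of `(X, T)` with respect to `μ`: there is a nonzero eigenfunction in
`L²(μ)`. -/
def IsMeasurableEigenvalue {X : Type*} [TopologicalSpace X] [MeasurableSpace X] (T : X ≃ₜ X)
    (μ : Measure X) (lam : ℂ) : Prop :=
  ∃ f : X → ℂ, MemLp f 2 μ ∧ ¬ f =ᵐ[μ] 0 ∧ ∀ᵐ x ∂μ, f (T x) = lam * f x

/-! ### Ordered Bratteli diagrams -/

/-- The raw data of an ordered Bratteli diagram. `V n` is the set of vertices of level `n`.
The edges with end-point `j : V (n + 1)` are linearly ordered and so they are numbered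
`0, …, deg n j - 1` in increasing order; `src n j o` is the initial point of the one
with number `o`. -/
structure OrderedDiagram where
  V : ℕ → Type
  deg : ∀ n, V (n + 1) → ℕ
  src : ∀ n (j : V (n + 1)), Fin (deg n j) → V n

namespace OrderedDiagram

variable (B : OrderedDiagram)

/-- The axioms of a Bratteli diagram: finite levels, one vertex of level `0`, every vertex of
positive level is an end-point, every vertex is an initial point. -/
structure IsBratteli : Prop where
  finite_V : ∀ n, Finite (B.V n)
  card_root : Nat.card (B.V 0) = 1
  deg_pos : ∀ n j, 0 < B.deg n j
  src_surj : ∀ n (i : B.V n), ∃ j o, B.src n j o = i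

/-- The edges from level `n` to level `n + 1`. -/
def Edge (n : ℕ) : Type := Σ j : B.V (n + 1), Fin (B.deg n j)

instance (n : ℕ) : TopologicalSpace (B.Edge n) := ⊥

instance (n : ℕ) : DiscreteTopology (B.Edge n) := ⟨rfl⟩

variable {B} in
/-- The end-point of an edge. -/
def Edge.target {n : ℕ} (e : B.Edge n) : B.V (n + 1) := e.1

variable {B} in
/-- The initial point of an edge. -/
def Edge.source {n : ℕ} (e : B.Edge n) : B.V n := B.src n e.1 e.2

variable {B} in
/-- The rank of an edge among the edges with the same end-point. -/
def Edge.pos {n : ℕ} (e : B.Edge n) : ℕ := e.2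

variable {B} in
def Edge.IsMin {n : ℕ} (e : B.Edge n) : Prop := e.pos = 0

variable {B} in
def Edge.IsMax {n : ℕ} (e : B.Edge n) : Prop := e.pos + 1 = B.deg n e.target

/-- The space of infinite paths; its topology is the one generated by the cylinder sets, that is,
the one induced by the product of the discrete topologies. -/
def Path : Type := {x : ∀ n, B.Edge n // ∀ n, (x n).target = (x (n + 1)).source}

instance : TopologicalSpace B.Path :=
  inferInstanceAs
    (TopologicalSpace {x : ∀ n, B.Edge n // ∀ n, (x n).target = (x (n + 1)).source})

instance : MeasurableSpace B.Path := borel _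

instance : BorelSpace B.Path := ⟨rfl⟩

/-- Properly ordered: a unique maximal path and a unique minimal path. -/
def IsProper : Prop :=
  (∃! x : B.Path, ∀ n, (x.1 n).IsMax) ∧ ∃! x : B.Path, ∀ n, (x.1 n).IsMin

/-- `T` is the Vershik map: it sends the maximal path to the minimal one. If `k` is the first
index at which `x` is not maximal, then it replaces the `k`-th edge by its successor, puts
minimal edges before it, and changes nothing after it. For a properly ordered Bratteli diagram
this determines `T`. -/
def IsVershik (T : B.Path → B.Path) : Prop :=
  (∀ x : B.Path, (∀ n, (x.1 n).IsMax) → ∀ n, ((T x).1 n).IsMin) ∧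
  ∀ (x : B.Path) (k : ℕ), (∀ i < k, (x.1 i).IsMax) → ¬ (x.1 k).IsMax →
    (∀ i < k, ((T x).1 i).IsMin) ∧
    ((T x).1 k).target = (x.1 k).target ∧ ((T x).1 k).pos = (x.1 k).pos + 1 ∧
    ∀ i > k, (T x).1 i = x.1 i

/-- The incidence matrix between levels `n` and `n + 1`: the entry `(j, i)` is the number of
edges from `i` to `j`. -/
noncomputable def incidence (n : ℕ) : Matrix (B.V (n + 1)) (B.V n) ℕ :=
  fun j i => Nat.card {o : Fin (B.deg n j) // B.src n j o = i}

/-- The number of paths from the root to a vertex of level `n`: the vector `H(n)`. -/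
def height : (n : ℕ) → B.V n → ℕ
  | 0, _ => 1
  | n + 1, j => ∑ o : Fin (B.deg n j), height n (B.src n j o)

end OrderedDiagram

/-- The system `(X, T)` is of topological finite rank `d`: it is conjugate to the
Bratteli-Vershik system of a properly ordered Bratteli diagram with at most `d` vertices at every
level `n ≥ 1`. -/
def HasFiniteRank {X : Type*} [TopologicalSpace X] (T : X ≃ₜ X) (d : ℕ) : Prop :=
  ∃ B : OrderedDiagram, B.IsBratteli ∧ B.IsProper ∧ (∀ n ≥ 1, Nat.card (B.V n) ≤ d) ∧
    ∃ S : B.Path ≃ₜ B.Path, B.IsVershik S ∧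
      ∃ g : X ≃ₜ B.Path, ∀ x, g (T x) = S (g x)

/-! ### The Fibonacci matrix and the best ordering

The vertices (letters) `1, 2` are written `0, 1 : Fin 2`. -/

namespace FibExample

/-- The matrix `A`. -/
def fibMatrix (R : Type*) [Zero R] [One R] : Matrix (Fin 2) (Fin 2) R := !![1, 1; 1, 0]

/-- The unit eigenvector of `A` for `φ` with positive coordinates. -/
noncomputable def eU : Fin 2 → ℝ :=
  (Real.sqrt (1 + Real.goldenRatio ^ 2))⁻¹ • ![Real.goldenRatio, 1]

/-- The unit eigenvector of `A` for `-φ⁻¹` with positive second coordinate. -/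
noncomputable def eS : Fin 2 → ℝ :=
  (Real.sqrt (1 + Real.goldenRatio ^ 2))⁻¹ • ![-1, Real.goldenRatio]

/-- The stable space of `A`. -/
def stableSpace : Set (Fin 2 → ℝ) :=
  {s | Tendsto (fun n : ℕ => (fibMatrix ℝ ^ n) *ᵥ s) atTop (𝓝 0)}

/-- The letter that follows the letters with sum vector `S` in the best ordering associated with
`(w, h)`: the letter `1` if `⟨S - h, w⟩ > 0` and the letter `2` otherwise. -/
noncomputable def bestNext (w : Fin 2 → ℝ) (h S : Fin 2 → ℕ) : Fin 2 :=
  open Classical in if 0 < (fun i => (S i : ℝ) - h i) ⬝ᵥ w then 0 else 1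

/-- The vector `e_{p 1} + ⋯ + e_{p n}` for the best ordering `p` associated with `(w, h)`. -/
noncomputable def bestSum (w : Fin 2 → ℝ) (h : Fin 2 → ℕ) : ℕ → Fin 2 → ℕ
  | 0 => 0
  | n + 1 => bestSum w h n + Pi.single (bestNext w h (bestSum w h n)) 1

/-- The letter `p (n + 1)` of the best ordering associated with `(w, h)`. -/
noncomputable def bestLetter (w : Fin 2 → ℝ) (h : Fin 2 → ℕ) (n : ℕ) : Fin 2 :=
  bestNext w h (bestSum w h n)

/-- The standing conditions under which the best ordering associated with `(w, h)` is considered: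
`w₂ ≥ 0`, `h` is strictly positive and `|w₁| / |w₂| < h₂ / h₁` (with denominators cleared). -/
def BestAdmissible (w : Fin 2 → ℝ) (h : Fin 2 → ℕ) : Prop :=
  0 ≤ w 1 ∧ (∀ i, 0 < h i) ∧ |w 0| * h 0 < h 1 * |w 1|

/-- One vertex at level `0`, two vertices at every other level. -/
def Vert : ℕ → Type
  | 0 => Unit
  | _ + 1 => Fin 2

/-- The diagram with one edge from the root to each of the vertices of level `1`, in which, for
`n ≥ 1`, the edges from level `n` to the vertex `j` of level `n + 1` are ordered by the best
ordering, of length `h₁ + h₂`, associated with `(w n, h)`, for `h` the `j`-th row of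
`A ^ k (n + 1)`. -/
noncomputable def bestDiagram (k : ℕ → ℕ) (w : ℕ → Fin 2 → ℝ) : OrderedDiagram where
  V := Vert
  deg
    | 0, _ => 1
    | n + 1, (j : Fin 2) => ∑ i, (fibMatrix ℕ ^ k (n + 2)) j i
  src
    | 0, _, _ => ()
    | n + 1, (j : Fin 2), o => bestLetter (w (n + 1)) ((fibMatrix ℕ ^ k (n + 2)) j) o

/-- The parameters of the construction: sequences `(ε n)` and `(δ n)`, `n ≥ 1`, and a number
`v₁`. -/
structure IsParameter (ε δ : ℕ → ℝ) (v₁ : ℝ) : Prop where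
  eps_mem : ∀ n ≥ 1, ε n ∈ Set.Ioc 0 Real.goldenRatio⁻¹
  delta_mem : ∀ n ≥ 1, δ n ∈ Set.Ioc 0 Real.goldenRatio⁻¹
  eps_anti : ∀ n ≥ 1, ε (n + 1) ≤ ε n
  delta_anti : ∀ n ≥ 1, δ (n + 1) ≤ δ n
  delta_le : ∀ n ≥ 1, δ n ≤ ε n
  summable : Summable ε
  v_mem : v₁ ∈ Set.Ioo 0 (ε 1)

/-- `K n = k 2 + ⋯ + k n`, so that `A ^ K n` is the product of the incidence matrices. -/
def cumSum (k : ℕ → ℕ) (n : ℕ) : ℕ := ∑ i ∈ Finset.Icc 2 n, k i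

/-- The vector `u n e_u + (v n + φ ^ (-K n) (s - v₁)) e_s`. -/
noncomputable def remainder (k : ℕ → ℕ) (u v : ℕ → ℝ) (v₁ s : ℝ) (n : ℕ) : Fin 2 → ℝ :=
  u n • eU + (v n + (Real.goldenRatio⁻¹) ^ cumSum k n * (s - v₁)) • eS

/-- The exponents `k n` (`n ≥ 2`) and the numbers of the construction with parameters `ε`, `δ`,
`v₁`. -/
structure Construction (ε δ : ℕ → ℝ) (v₁ : ℝ) where
  k : ℕ → ℕ
  β : ℝ
  /-- The number for which `(1, 0) + β e_u + t e_s` lies on the line spanned by `H(1)`. -/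
  t : ℝ
  α : ℝ
  z : ℕ → Fin 2 → ℤ
  u : ℕ → ℝ
  v : ℕ → ℝ
  k_gt : ∀ n ≥ 2, 2 < k n
  k_eps : ∀ n ≥ 2, (Real.goldenRatio⁻¹) ^ k n ≤ ε n
  β_mem : β ∈ Set.Ioo (0 : ℝ) 1
  v_one : v 1 = v₁
  v_mem : ∀ n ≥ 1, v n ∈ Set.Ioo 0 (ε n)
  u_mem : ∀ n ≥ 1, u n ∈ Set.Ioc 0 (δ n * v n)
  decomp : ∀ n ≥ 1, ∀ s > v₁,
    (fibMatrix ℝ ^ cumSum k n) *ᵥ (β • eU + s • eS) =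
      (fun i => (z n i : ℝ)) + remainder k u v v₁ s n
  t_gt : v₁ < t
  α_eq : α • ![1, 1] = ![1, 0] + β • eU + t • eS
  admissible : ∀ n ≥ 1, ∀ j,
    BestAdmissible (remainder k u v v₁ t n) ((fibMatrix ℕ ^ k (n + 1)) j)

/-- The vector `w n`, which differs from `α H(n)` by an integer vector. -/
noncomputable def Construction.w {ε δ : ℕ → ℝ} {v₁ : ℝ} (D : Construction ε δ v₁) (n : ℕ) :
    Fin 2 → ℝ :=
  remainder D.k D.u D.v v₁ D.t n

/-- The ordered Bratteli diagram of the construction. -/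
noncomputable def Construction.diagram {ε δ : ℕ → ℝ} {v₁ : ℝ} (D : Construction ε δ v₁) :
    OrderedDiagram :=
  bestDiagram D.k D.w

end FibExample

/-! ### Ordered Bratteli diagrams: towers and the Vershik map -/

namespace OrderedDiagram

variable {B : OrderedDiagram}

/-! Write λ = exp(2iπα). Since A preserves ℤ², the decomposition of A^{K_n}(βe_u + te_s) gives αH(n)
≡ w_n modulo ℤ² (`exists_alpha_mul_height`), and w_n → 0 although its e_u-component u_n is never 0.
If αH(m) were in ℤ² + E^s, then w_n would eventually be the image under a power of A of a stable
vector, with no integer correction, and u_n would vanish.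

For a measurable eigenfunction, take λ to the power `rank x n`, the floor of x in its tower of level
n. Passing to the next level multiplies this by λ to a partial height. Modulo 1, α times that
partial height is the defect ⟨S - h, w_n⟩ of the best ordering plus an entry of w_{n+1}. The
ordering is greedy: after its initial block of letters `1` the defect stays between w_n(0) and
w_n(1), hence is O(ε_n). The initial block has about ⟨h, w_n⟩ / w_n(1) letters. The vector of base
measures of an invariant measure is a multiple of e_u, so averaging ⟨h, w_n⟩ over the rows sees only
u_n. The set where the defect is large thus has measure O(u_n / v_n) + O(ε_{n+1}), with u_n ≤ δ_n
v_n (`measureReal_badSet_le`). This is summable; Borel–Cantelli gives almost sure convergence.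

A continuous eigenfunction fails on that same initial block. There the phases m·w_n(1) climb from 0
to ⟨h, w_n⟩ in small steps while the points visited stay near the minimal path, so continuity forces
⟨h, w_n⟩ < 1/2. Then A^{k_{n+1}} w_n = w_{n+1} with no integer correction, hence u_{n+1} ≥ u_n
eventually, against 0 < u_n → 0 (`not_eventually_rowDot_lt`).

The dynamics rests on the first letter always being `1` and the last `0`: minimal edges share a
source, and so do maximal ones, which gives proper ordering and a continuous Vershik map.
Contraction of A along e_s gives unique ergodicity.

The data are built by choosing β as a series whose terms are the e_u-components of lattice vectors
A^m(1,0), scaled back by φ^{-K_n}. Removing such a vector at each step keeps u_n tiny compared with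
v_n (`exists_step`, `exists_int_seq`). -/

theorem Edge.eq_of_target_pos {n : ℕ} {e e' : B.Edge n} (h : e.target = e'.target)
    (h' : e.pos = e'.pos) : e = e' := by
  obtain ⟨j, o⟩ := e
  obtain ⟨j', o'⟩ := e'
  obtain rfl : j = j' := h
  obtain rfl : o = o' := Fin.ext h'
  rfl

theorem Edge.pos_lt {n : ℕ} (e : B.Edge n) : e.pos < B.deg n e.target := e.2.2

theorem Path.ext {x y : B.Path} (h : ∀ i, x.1 i = y.1 i) : x = y := Subtype.ext (funext h)

variable (B) in
/-- The sum of the heights of the initial points of the first `m` edges with end-point `j`. -/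
def partialHeight (n : ℕ) (j : B.V (n + 1)) (m : ℕ) : ℕ :=
  ∑ o : Fin (B.deg n j) with o.1 < m, B.height n (B.src n j o)

@[simp]
theorem partialHeight_zero (n : ℕ) (j : B.V (n + 1)) : B.partialHeight n j 0 = 0 := by
  simp [partialHeight]

theorem partialHeight_succ {n : ℕ} {j : B.V (n + 1)} (o : Fin (B.deg n j)) :
    B.partialHeight n j (o + 1) = B.partialHeight n j o + B.height n (B.src n j o) := by
  have : (Finset.univ.filter fun o' : Fin (B.deg n j) => o'.1 < o.1 + 1) =
      insert o (Finset.univ.filter fun o' : Fin (B.deg n j) => o'.1 < o.1) := by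
    ext o'
    simp [Fin.ext_iff]
    omega
  rw [partialHeight, this, Finset.sum_insert (by simp), add_comm]
  rfl

theorem partialHeight_deg (n : ℕ) (j : B.V (n + 1)) :
    B.partialHeight n j (B.deg n j) = B.height (n + 1) j := by
  simp [partialHeight, height]

theorem partialHeight_mono (n : ℕ) (j : B.V (n + 1)) : Monotone (B.partialHeight n j) := by
  intro m m' h
  refine Finset.sum_le_sum_of_subset fun o => ?_
  simp
  omega

theorem partialHeight_add_height_le {n : ℕ} (e : B.Edge n) :
    B.partialHeight n e.target e.pos + B.height n e.source ≤ B.height (n + 1) e.target := by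
  rw [← partialHeight_deg]
  exact (partialHeight_succ e.2).symm.trans_le (partialHeight_mono _ _ e.pos_lt)

/-- The number of steps from the bottom of its tower of level `n` to the point `x`. -/
def rank (x : B.Path) : ℕ → ℕ
  | 0 => 0
  | n + 1 => rank x n + B.partialHeight n (x.1 n).target (x.1 n).pos

theorem rank_succ (x : B.Path) (n : ℕ) :
    rank x (n + 1) = rank x n + B.partialHeight n (x.1 n).target (x.1 n).pos := rfl

theorem rank_congr {x y : B.Path} {n : ℕ} (h : ∀ i < n, x.1 i = y.1 i) : rank x n = rank y n := by
  induction n with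
  | zero => rfl
  | succ n ih => rw [rank_succ, rank_succ, ih fun i hi => h i (by omega), h n (by omega)]

theorem rank_eq_zero_of_isMin {x : B.Path} {n : ℕ} (h : ∀ i < n, (x.1 i).IsMin) :
    rank x n = 0 := by
  induction n with
  | zero => rfl
  | succ n ih =>
    have : (x.1 n).pos = 0 := h n (by omega)
    rw [rank_succ, ih fun i hi => h i (by omega), this, partialHeight_zero]

theorem rank_add_one_of_isMax {x : B.Path} {n : ℕ} (h : ∀ i < n, (x.1 i).IsMax) :
    rank x n + 1 = B.height n (x.1 n).source := by
  induction n with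
  | zero => rfl
  | succ n ih =>
    have h1 : (x.1 n).pos + 1 = B.deg n (x.1 n).target := h n (by omega)
    have h2 := partialHeight_succ (x.1 n).2
    have h3 := ih fun i hi => h i (by omega)
    have h4 := partialHeight_deg n (x.1 n).target
    rw [← h1] at h4
    rw [rank_succ, ← x.2 n, ← h4]
    refine Eq.trans ?_ h2.symm
    change _ = B.partialHeight n (x.1 n).target (x.1 n).pos + B.height n (x.1 n).source
    omega

theorem rank_lt_height (x : B.Path) (n : ℕ) : rank x n < B.height n (x.1 n).source := by
  induction n with
  | zero => exact Nat.one_pos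
  | succ n ih =>
    have := partialHeight_add_height_le (x.1 n)
    rw [rank_succ, ← x.2 n]
    omega

theorem partialHeight_lt_height {n : ℕ} {j : B.V (n + 1)} {o o' : Fin (B.deg n j)} (h : o < o') :
    B.partialHeight n j o + B.height n (B.src n j o) ≤ B.partialHeight n j o' := by
  rw [← partialHeight_succ]
  exact partialHeight_mono _ _ h

/-- The edges ending at a given vertex occupy disjoint intervals of ranks, the one numbered o
starting at `partialHeight n j o` with length the height of its source. A rank therefore determines
the last edge and, by induction, all earlier ones. -/
theorem eq_of_rank_eq {x y : B.Path} {n : ℕ} (hs : (x.1 n).source = (y.1 n).source)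
    (hr : rank x n = rank y n) : ∀ i < n, x.1 i = y.1 i := by
  induction n with
  | zero => simp
  | succ n ih =>
    have hx := rank_lt_height x n
    have hy := rank_lt_height y n
    rw [← x.2 n, ← y.2 n] at hs
    rw [rank_succ, rank_succ] at hr
    have key : x.1 n = y.1 n := by
      generalize x.1 n = e at *
      generalize y.1 n = e' at *
      obtain ⟨j, o⟩ := e
      obtain ⟨j', o'⟩ := e'
      obtain rfl : j = j' := hs
      change rank x n + B.partialHeight n j o = rank y n + B.partialHeight n j o' at hr
      change rank x n < B.height n (B.src n j o) at hx
      change rank y n < B.height n (B.src n j o') at hy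
      rcases lt_trichotomy o o' with h | rfl | h
      · have := partialHeight_lt_height h
        omega
      · rfl
      · have := partialHeight_lt_height h
        omega
    rw [key] at hr
    intro i hi
    rcases Nat.lt_succ_iff_lt_or_eq.1 hi with hi | rfl
    · exact ih (by rw [key]) (by omega) i hi
    · exact key

theorem eq_of_eq_ge_of_isMin {x y : B.Path} {n : ℕ} (h : ∀ i ≥ n, x.1 i = y.1 i)
    (hx : ∀ i < n, (x.1 i).IsMin) (hy : ∀ i < n, (y.1 i).IsMin) : x = y :=
  Path.ext fun i => (lt_or_ge i n).elim
    (eq_of_rank_eq (by rw [h n le_rfl])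
      ((rank_eq_zero_of_isMin hx).trans (rank_eq_zero_of_isMin hy).symm) i) (h i)

theorem eq_of_eq_ge_of_isMax {x y : B.Path} {n : ℕ} (h : ∀ i ≥ n, x.1 i = y.1 i)
    (hx : ∀ i < n, (x.1 i).IsMax) (hy : ∀ i < n, (y.1 i).IsMax) : x = y := by
  refine Path.ext fun i => (lt_or_ge i n).elim (eq_of_rank_eq (by rw [h n le_rfl]) ?_ i) (h i)
  have h1 := rank_add_one_of_isMax hx
  have h2 := rank_add_one_of_isMax hy
  rw [h n le_rfl] at h1
  omega

theorem height_pos (hB : B.IsBratteli) (n : ℕ) (j : B.V n) : 0 < B.height n j := by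
  induction n with
  | zero => exact Nat.one_pos
  | succ n ih =>
    have : Nonempty (Fin (B.deg n j)) := ⟨⟨0, hB.deg_pos n j⟩⟩
    exact Finset.sum_pos (fun _ _ => ih _) Finset.univ_nonempty

theorem isMin_of_rank_eq_zero (hB : B.IsBratteli) {x : B.Path} {n : ℕ} (h : rank x n = 0) :
    ∀ i < n, (x.1 i).IsMin := by
  induction n with
  | zero => simp
  | succ n ih =>
    rw [rank_succ, Nat.add_eq_zero_iff] at h
    intro i hi
    rcases Nat.lt_succ_iff_lt_or_eq.1 hi with hi | rfl
    · exact ih h.1 i hi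
    · by_contra hne
      have hlt : (⟨0, hB.deg_pos _ _⟩ : Fin (B.deg i (x.1 i).target)) < (x.1 i).2 :=
        Nat.pos_of_ne_zero hne
      have := partialHeight_lt_height hlt
      have h2 := height_pos hB i (B.src i (x.1 i).target ⟨0, hB.deg_pos _ _⟩)
      have h3 : B.partialHeight i (x.1 i).target (x.1 i).2 = 0 := h.2
      omega

/-! #### Prescribing the end of a path -/

/-- The path is completed downwards, one edge at a time. `P` is kept general to serve for both
minimal and maximal initial segments. -/
theorem exists_path_of_tail (P : ∀ n, B.Edge n → Prop)
    (hP : ∀ n (j : B.V (n + 1)), ∃ e : B.Edge n, e.target = j ∧ P n e) (k : ℕ) :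
    ∀ g : ∀ n, B.Edge n, (∀ n ≥ k, (g n).target = (g (n + 1)).source) →
      ∃ x : B.Path, (∀ n ≥ k, x.1 n = g n) ∧ ∀ n < k, P n (x.1 n) := by
  induction k with
  | zero => exact fun g hg => ⟨⟨g, fun n => hg n (Nat.zero_le n)⟩, by simp, by simp⟩
  | succ k ih =>
    intro g hg
    obtain ⟨e, he, hPe⟩ := hP k (g (k + 1)).source
    obtain ⟨x, hx, hx'⟩ := ih (Function.update g k e) (by
      intro n hn
      rcases Nat.eq_or_lt_of_le hn with rfl | hlt
      · simpa using he
      · simpa [Function.update_of_ne hlt.ne',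
          Function.update_of_ne (show n + 1 ≠ k by omega)] using hg n hlt)
    refine ⟨x, fun n hn => ?_, fun n hn => ?_⟩
    · rw [hx n (by omega), Function.update_of_ne (by omega)]
    · rcases Nat.lt_succ_iff_lt_or_eq.1 hn with hn | rfl
      · exact hx' n hn
      · rw [hx n le_rfl]
        simpa using hPe

theorem exists_isMin (hB : B.IsBratteli) (n : ℕ) (j : B.V (n + 1)) :
    ∃ e : B.Edge n, e.target = j ∧ e.IsMin := ⟨⟨j, 0, hB.deg_pos n j⟩, rfl, rfl⟩

theorem exists_isMax (hB : B.IsBratteli) (n : ℕ) (j : B.V (n + 1)) :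
    ∃ e : B.Edge n, e.target = j ∧ e.IsMax :=
  ⟨⟨j, B.deg n j - 1, Nat.sub_lt (hB.deg_pos n j) Nat.one_pos⟩, rfl,
    Nat.sub_add_cancel (hB.deg_pos n j)⟩

theorem exists_edge_pos {n : ℕ} {e : B.Edge n} {m : ℕ} (h : m < B.deg n e.target) :
    ∃ e' : B.Edge n, e'.target = e.target ∧ e'.pos = m := ⟨⟨e.target, m, h⟩, rfl, rfl⟩

theorem exists_path_of_edge (P : ∀ n, B.Edge n → Prop)
    (hP : ∀ n (j : B.V (n + 1)), ∃ e : B.Edge n, e.target = j ∧ P n e) (x : B.Path) {k : ℕ}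
    {e : B.Edge k} (he : e.target = (x.1 k).target) :
    ∃ y : B.Path, (∀ n > k, y.1 n = x.1 n) ∧ y.1 k = e ∧ ∀ n < k, P n (y.1 n) := by
  obtain ⟨y, hy, hy'⟩ := exists_path_of_tail P hP k (Function.update x.1 k e) (by
    intro n hn
    rcases Nat.eq_or_lt_of_le hn with rfl | hlt
    · simpa [he] using x.2 k
    · simpa [Function.update_of_ne hlt.ne',
        Function.update_of_ne (show n + 1 ≠ k by omega)] using x.2 n)
  refine ⟨y, fun n hn => ?_, ?_, hy'⟩
  · rw [hy n (by omega), Function.update_of_ne (by omega)]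
  · rw [hy k le_rfl, Function.update_self]

/-! #### The action of the Vershik map on the towers -/

theorem exists_first_not {P : ℕ → Prop} (h : ¬ ∀ n, P n) : ∃ k, (∀ i < k, P i) ∧ ¬ P k := by
  classical
  push Not at h
  exact ⟨Nat.find h, fun i hi => not_not.1 (Nat.find_min h hi), Nat.find_spec h⟩

theorem exists_first_not_lt {P : ℕ → Prop} {n : ℕ} (h : ¬ ∀ i < n, P i) :
    ∃ k < n, (∀ i < k, P i) ∧ ¬ P k := by
  obtain ⟨k, hk, hk'⟩ := exists_first_not (P := P) fun h' => h fun i _ => h' i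
  exact ⟨k, by by_contra hn; exact h fun i hi => hk i (by omega), hk, hk'⟩

theorem IsVershik.apply_eq_of_not_isMax {T : B.Path → B.Path} (hT : B.IsVershik T) {x : B.Path}
    {n : ℕ} (h : ¬ ∀ i < n, (x.1 i).IsMax) : ∀ i ≥ n, (T x).1 i = x.1 i := by
  obtain ⟨k, hkn, hk, hk'⟩ := exists_first_not_lt h
  exact fun i hi => (hT.2 x k hk hk').2.2.2 i (by omega)

theorem source_eq_of_eq_ge {x y : B.Path} {n : ℕ} (h : ∀ i ≥ n, x.1 i = y.1 i) :
    (x.1 n).source = (y.1 n).source := by rw [h n le_rfl]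

/-- This is the carry of an odometer: the maximal prefix, of rank one less than the height of its
end-point, drops to rank 0, while the successor of the next edge contributes exactly that height
more. -/
theorem IsVershik.rank_apply {T : B.Path → B.Path} (hT : B.IsVershik T) {x : B.Path}
    {n : ℕ} (h : ¬ ∀ i < n, (x.1 i).IsMax) : rank (T x) n = rank x n + 1 := by
  obtain ⟨k, hkn, hk, hk'⟩ := exists_first_not_lt h
  obtain ⟨h1, h2, h3, h4⟩ := hT.2 x k hk hk'
  clear h
  induction n with
  | zero => omega
  | succ n ih =>
    rcases Nat.lt_succ_iff_lt_or_eq.1 hkn with hlt | rfl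
    · rw [rank_succ, rank_succ, ih hlt, h4 n hlt]
      omega
    · have h5 := rank_add_one_of_isMax hk
      have h6 : B.partialHeight k (x.1 k).target ((x.1 k).pos + 1) = _ :=
        partialHeight_succ (x.1 k).2
      rw [rank_succ, rank_succ, rank_eq_zero_of_isMin h1, h2, h3, h6]
      change 0 + (B.partialHeight k (x.1 k).target (x.1 k).pos + B.height k (x.1 k).source) = _
      omega

theorem IsVershik.rank_apply_of_isMax {T : B.Path → B.Path}
    (hT : B.IsVershik T) {x : B.Path} {n : ℕ} (h : ∀ i < n, (x.1 i).IsMax) :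
    rank (T x) n = 0 := by
  apply rank_eq_zero_of_isMin
  by_cases hx : ∀ i, (x.1 i).IsMax
  · exact fun i _ => hT.1 x hx i
  · obtain ⟨k, hk, hk'⟩ := exists_first_not hx
    have hnk : n ≤ k := by
      by_contra hlt
      exact hk' (h k (by omega))
    exact fun i hi => (hT.2 x k hk hk').1 i (by omega)

theorem IsVershik.rank_iterate {T : B.Path → B.Path} (hT : B.IsVershik T) {x : B.Path} {n : ℕ}
    (m : ℕ) (hm : rank x n + m < B.height n (x.1 n).source) :
    rank (T^[m] x) n = rank x n + m ∧ ∀ i ≥ n, (T^[m] x).1 i = x.1 i := by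
  induction m with
  | zero => simp
  | succ m ih =>
    obtain ⟨h1, h2⟩ := ih (by omega)
    have hmax : ¬ ∀ i < n, ((T^[m] x).1 i).IsMax := by
      intro hmax
      have := rank_add_one_of_isMax hmax
      rw [h2 n le_rfl] at this
      omega
    rw [Function.iterate_succ_apply', hT.rank_apply hmax, h1]
    exact ⟨rfl, fun i hi => (hT.apply_eq_of_not_isMax hmax i hi).trans (h2 i hi)⟩

/-- Two paths with the same end, the second one higher in the tower, are in the same orbit. -/
theorem IsVershik.iterate_eq {T : B.Path → B.Path} (hT : B.IsVershik T) {x y : B.Path} {n : ℕ}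
    (h : ∀ i ≥ n, x.1 i = y.1 i) (hr : rank x n ≤ rank y n) :
    T^[rank y n - rank x n] x = y := by
  have hlt := rank_lt_height y n
  rw [← source_eq_of_eq_ge h] at hlt
  obtain ⟨h1, h2⟩ := hT.rank_iterate (x := x) (n := n) (rank y n - rank x n) (by omega)
  have h3 : ∀ i ≥ n, (T^[rank y n - rank x n] x).1 i = y.1 i := fun i hi =>
    (h2 i hi).trans (h i hi)
  exact Path.ext fun i => (lt_or_ge i n).elim
    (eq_of_rank_eq (source_eq_of_eq_ge h3) (by omega) i) (h3 i)

/-! #### Existence of the Vershik map -/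

theorem exists_isVershik (hB : B.IsBratteli) (hP : B.IsProper) :
    ∃ T : B.Path → B.Path, B.IsVershik T := by
  have key : ∀ x : B.Path, ∃ y : B.Path, ((∀ n, (x.1 n).IsMax) → ∀ n, (y.1 n).IsMin) ∧
      ∀ k : ℕ, (∀ i < k, (x.1 i).IsMax) → ¬ (x.1 k).IsMax →
        (∀ i < k, (y.1 i).IsMin) ∧ (y.1 k).target = (x.1 k).target ∧
          (y.1 k).pos = (x.1 k).pos + 1 ∧ ∀ i > k, y.1 i = x.1 i := by
    intro x
    by_cases hx : ∀ i, (x.1 i).IsMax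
    · obtain ⟨y, hy, -⟩ := hP.2
      exact ⟨y, fun _ => hy, fun k _ hk => absurd (hx k) hk⟩
    · obtain ⟨k, hk, hk'⟩ := exists_first_not hx
      obtain ⟨e, he, hpos⟩ := exists_edge_pos (e := x.1 k) (m := (x.1 k).pos + 1)
        (lt_of_le_of_ne (x.1 k).pos_lt hk')
      obtain ⟨y, hy, hye, hmin⟩ := exists_path_of_edge _ (exists_isMin hB) x he
      refine ⟨y, fun h => absurd h hx, fun k' h1 h2 => ?_⟩
      obtain rfl : k' = k := by
        rcases lt_trichotomy k k' with h | h | h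
        · exact absurd (h1 k h) hk'
        · exact h.symm
        · exact absurd (hk k' h) h2
      exact ⟨hmin, by rw [hye, he], by rw [hye, hpos], hy⟩
  choose T hT using key
  exact ⟨T, fun x => (hT x).1, fun x => (hT x).2⟩

/-- The first non-maximal index of x is the first non-minimal index of T x, so the image reveals
where the carry stopped, and with it the edge replaced and the maximal prefix. -/
theorem IsVershik.injective (hP : B.IsProper) {T : B.Path → B.Path} (hT : B.IsVershik T) :
    Function.Injective T := by
  have aux : ∀ (x : B.Path) (k : ℕ), (∀ i < k, (x.1 i).IsMax) → ¬ (x.1 k).IsMax →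
      ¬ ((T x).1 k).IsMin := by
    intro x k h1 h2 h3
    have h4 : ((T x).1 k).pos = 0 := h3
    have := (hT.2 x k h1 h2).2.2.1
    omega
  intro x x' hxx
  by_cases hx : ∀ i, (x.1 i).IsMax <;> by_cases hx' : ∀ i, (x'.1 i).IsMax
  · exact hP.1.unique hx hx'
  · obtain ⟨k, hk, hk'⟩ := exists_first_not hx'
    exact absurd (hT.1 x hx k) (hxx ▸ aux x' k hk hk')
  · obtain ⟨k, hk, hk'⟩ := exists_first_not hx
    exact absurd (hT.1 x' hx' k) (hxx ▸ aux x k hk hk')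
  · obtain ⟨k, hk, hk'⟩ := exists_first_not hx
    obtain ⟨l, hl, hl'⟩ := exists_first_not hx'
    have h1 := hT.2 x k hk hk'
    have h2 := hT.2 x' l hl hl'
    obtain rfl : k = l := by
      rcases lt_trichotomy k l with h | h | h
      · exact absurd (h2.1 k h) (hxx ▸ aux x k hk hk')
      · exact h
      · exact absurd (h1.1 l h) (hxx ▸ aux x' l hl hl')
    rw [hxx] at h1
    have hkk : x.1 k = x'.1 k := Edge.eq_of_target_pos (h1.2.1.symm.trans h2.2.1) (by
      have := h1.2.2.1
      have := h2.2.2.1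
      omega)
    refine eq_of_eq_ge_of_isMax (n := k) (fun i hi => ?_) hk hl
    rcases Nat.eq_or_lt_of_le hi with rfl | hi
    · exact hkk
    · exact (h1.2.2.2 i hi).symm.trans (h2.2.2.2 i hi)

theorem IsVershik.surjective (hB : B.IsBratteli) (hP : B.IsProper) {T : B.Path → B.Path}
    (hT : B.IsVershik T) : Function.Surjective T := by
  intro y
  by_cases hy : ∀ i, (y.1 i).IsMin
  · obtain ⟨x, hx, -⟩ := hP.1
    exact ⟨x, hP.2.unique (hT.1 x hx) hy⟩
  · obtain ⟨k, hk, hk'⟩ := exists_first_not hy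
    have hpos : (y.1 k).pos ≠ 0 := hk'
    have hlt := (y.1 k).pos_lt
    obtain ⟨e, he, hepos⟩ := exists_edge_pos (e := y.1 k) (m := (y.1 k).pos - 1) (by omega)
    obtain ⟨x, hx, hxe, hmax⟩ := exists_path_of_edge _ (exists_isMax hB) y he
    have hx' : ¬ (x.1 k).IsMax := by
      rw [hxe, Edge.IsMax, he, hepos]
      omega
    obtain ⟨h1, h2, h3, h4⟩ := hT.2 x k hmax hx'
    refine ⟨x, eq_of_eq_ge_of_isMin (n := k) (fun i hi => ?_) h1 hk⟩
    rcases Nat.eq_or_lt_of_le hi with rfl | hi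
    · refine Edge.eq_of_target_pos (h2.trans (by rw [hxe, he])) (h3.trans ?_)
      rw [hxe, hepos]
      omega
    · exact (h4 i hi).trans (hx i hi)

/-! #### Topology of the path space -/

/-- The paths with the same first `n` edges as `x`. -/
def cyl (x : B.Path) (n : ℕ) : Set B.Path := {y | ∀ i < n, y.1 i = x.1 i}

theorem mem_cyl_self (x : B.Path) (n : ℕ) : x ∈ cyl x n := fun _ _ => rfl

theorem cyl_eq_of_mem {x y : B.Path} {n : ℕ} (h : y ∈ cyl x n) : cyl y n = cyl x n := by
  ext z
  exact forall₂_congr fun i hi => by rw [h i hi]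

theorem cyl_anti (x : B.Path) : Antitone (cyl x) := fun _ _ h _ hy i hi => hy i (hi.trans_le h)

theorem continuous_coord (i : ℕ) : Continuous fun x : B.Path => x.1 i :=
  (continuous_apply i).comp continuous_subtype_val

theorem isClopen_cyl (x : B.Path) (n : ℕ) : IsClopen (cyl x n) := by
  have : cyl x n = ⋂ i ∈ Set.Iio n, (fun y : B.Path => y.1 i) ⁻¹' {x.1 i} := by
    ext y
    simp [cyl]
  rw [this]
  exact (Set.finite_Iio n).isClopen_biInter fun i _ =>
    (isClopen_discrete _).preimage (continuous_coord i)

theorem exists_cyl_subset {x : B.Path} {U : Set B.Path} (hU : IsOpen U) (hx : x ∈ U) :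
    ∃ n, cyl x n ⊆ U := by
  obtain ⟨V, hV, rfl⟩ := isOpen_induced_iff.1 hU
  obtain ⟨I, u, hu, hIu⟩ := isOpen_pi_iff.1 hV x.1 hx
  refine ⟨I.sup id + 1, fun y hy => hIu fun i hi => ?_⟩
  rw [hy i (Nat.lt_succ_of_le (Finset.le_sup (f := id) hi))]
  exact (hu i hi).2

theorem isTopologicalBasis_cyl :
    TopologicalSpace.IsTopologicalBasis (Set.range fun p : B.Path × ℕ => cyl p.1 p.2) := by
  refine TopologicalSpace.isTopologicalBasis_of_isOpen_of_nhds ?_ ?_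
  · rintro _ ⟨p, rfl⟩
    exact (isClopen_cyl p.1 p.2).isOpen
  · intro x U hx hU
    obtain ⟨n, hn⟩ := exists_cyl_subset hU hx
    exact ⟨_, ⟨(x, n), rfl⟩, mem_cyl_self x n, hn⟩

instance : T2Space B.Path :=
  inferInstanceAs
    (T2Space {x : ∀ n, B.Edge n // ∀ n, (x n).target = (x (n + 1)).source})

theorem finite_edge (hB : B.IsBratteli) (n : ℕ) : Finite (B.Edge n) :=
  have := hB.finite_V (n + 1)
  inferInstanceAs (Finite (Σ j : B.V (n + 1), Fin (B.deg n j)))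

theorem compactSpace_path (hB : B.IsBratteli) : CompactSpace B.Path := by
  have := finite_edge hB
  have hc : IsClosed {x : ∀ n, B.Edge n | ∀ n, (x n).target = (x (n + 1)).source} := by
    rw [Set.ofPred_forall]
    refine isClosed_iInter fun n => ?_
    have h := (isClosed_discrete {p : B.Edge n × B.Edge (n + 1) | p.1.target = p.2.source}).preimage
      ((continuous_apply n).prodMk (continuous_apply (n + 1)) :
        Continuous fun x : ∀ n, B.Edge n => (x n, x (n + 1)))
    exact h
  exact isCompact_iff_compactSpace.1 hc.isCompact

theorem countable_cyl (hB : B.IsBratteli) :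
    (Set.range fun p : B.Path × ℕ => cyl p.1 p.2).Countable := by
  have := finite_edge hB
  have : (Set.range fun p : B.Path × ℕ => cyl p.1 p.2) ⊆
      Set.range fun q : Σ n, ∀ i : Fin n, B.Edge i =>
        {y : B.Path | ∀ i (hi : i < q.1), y.1 i = q.2 ⟨i, hi⟩} := by
    rintro _ ⟨p, rfl⟩
    exact ⟨⟨p.2, fun i => p.1.1 i⟩, rfl⟩
  exact (Set.countable_range _).mono this

theorem secondCountable_path (hB : B.IsBratteli) : SecondCountableTopology B.Path :=
  isTopologicalBasis_cyl.secondCountableTopology (countable_cyl hB)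

theorem generateFrom_cyl (hB : B.IsBratteli) :
    (inferInstance : MeasurableSpace B.Path) =
      MeasurableSpace.generateFrom (Set.range fun p : B.Path × ℕ => cyl p.1 p.2) := by
  have := secondCountable_path hB
  exact isTopologicalBasis_cyl.borel_eq_generateFrom

theorem isPiSystem_cyl : IsPiSystem (Set.range fun p : B.Path × ℕ => cyl p.1 p.2) := by
  rintro _ ⟨⟨x, n⟩, rfl⟩ _ ⟨⟨y, m⟩, rfl⟩ ⟨z, hzx, hzy⟩
  dsimp only at hzx hzy ⊢
  rw [← cyl_eq_of_mem hzx, ← cyl_eq_of_mem hzy]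
  rcases le_total n m with h | h
  · exact ⟨(z, m), (Set.inter_eq_right.2 (cyl_anti z h)).symm⟩
  · exact ⟨(z, n), (Set.inter_eq_left.2 (cyl_anti z h)).symm⟩

end OrderedDiagram

/-! ### Diagrams in which all minimal (maximal) edges of a level have the same initial point -/

namespace OrderedDiagram

variable {B : OrderedDiagram}

variable (B) in
/-- All minimal edges that start from level `n` start from `vmin n`, all maximal ones from
`vmax n`. -/
structure HasExtremalSources (vmin vmax : ∀ n, B.V n) : Prop where
  isMin : ∀ n (e : B.Edge n), e.IsMin → e.source = vmin n
  isMax : ∀ n (e : B.Edge n), e.IsMax → e.source = vmax n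

/-- The common source of the distinguished edges leaving level n + 1 prescribes the target of the
edge before them, so every edge is forced. -/
theorem existsUnique_path {P : ∀ n, B.Edge n → Prop} {v : ∀ n, B.V n}
    (hP : ∀ n (j : B.V (n + 1)), ∃! e : B.Edge n, e.target = j ∧ P n e)
    (hv : ∀ n e, P n e → e.source = v n) : ∃! x : B.Path, ∀ n, P n (x.1 n) := by
  choose e he huniq using fun n => hP n (v (n + 1))
  refine ⟨⟨e, fun n => ?_⟩, fun n => (he n).2, fun y hy => Path.ext fun n => ?_⟩
  · rw [(he n).1, hv _ _ (he (n + 1)).2]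
  · exact huniq n _ ⟨(y.2 n).trans (hv _ _ (hy (n + 1))), hy n⟩

variable {vmin vmax : ∀ n, B.V n}

theorem HasExtremalSources.isProper (hB : B.IsBratteli) (h : B.HasExtremalSources vmin vmax) :
    B.IsProper := by
  refine ⟨existsUnique_path (fun n j => ?_) h.isMax, existsUnique_path (fun n j => ?_) h.isMin⟩
  · obtain ⟨e, he, hm⟩ := exists_isMax hB n j
    refine ⟨e, ⟨he, hm⟩, fun e' he' => Edge.eq_of_target_pos (he'.1.trans he.symm) ?_⟩
    have h1 : e.pos + 1 = B.deg n e.target := hm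
    have h2 : e'.pos + 1 = B.deg n e'.target := he'.2
    rw [he] at h1
    rw [he'.1] at h2
    omega
  · obtain ⟨e, he, hm⟩ := exists_isMin hB n j
    exact ⟨e, ⟨he, hm⟩, fun e' he' => Edge.eq_of_target_pos (he'.1.trans he.symm)
      (Eq.trans he'.2 (Eq.symm hm))⟩

theorem HasExtremalSources.eq_of_isMin (h : B.HasExtremalSources vmin vmax) {x y : B.Path} {n : ℕ}
    (hx : ∀ i ≤ n, (x.1 i).IsMin) (hy : ∀ i ≤ n, (y.1 i).IsMin) : ∀ i < n, x.1 i = y.1 i := by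
  refine fun i hi => Edge.eq_of_target_pos ?_ (Eq.trans (hx i hi.le) (Eq.symm (hy i hi.le)))
  rw [x.2, y.2, h.isMin _ _ (hx (i + 1) hi), h.isMin _ _ (hy (i + 1) hi)]

/-- The paths that are minimal up to level `n` converge to the minimal path. -/
theorem HasExtremalSources.eventually_of_mem_nhds (h : B.HasExtremalSources vmin vmax)
    {x : B.Path} (hx : ∀ i, (x.1 i).IsMin) {U : Set B.Path} (hU : U ∈ 𝓝 x) :
    ∃ N, ∀ y : B.Path, (∀ i < N, (y.1 i).IsMin) → y ∈ U := by
  obtain ⟨V, hVU, hV, hxV⟩ := mem_nhds_iff.1 hU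
  obtain ⟨n, hn⟩ := exists_cyl_subset hV hxV
  exact ⟨n + 1, fun y hy => hVU (hn (h.eq_of_isMin (fun i hi => hy i (by omega))
    fun i _ => hx i))⟩

/-- Off the maximal path, finitely many coordinates of the image depend on finitely many of the
argument. Near the maximal path, a long maximal prefix becomes a long minimal one, and such paths
converge to the minimal path because minimal edges share their source. -/
theorem HasExtremalSources.continuous (h : B.HasExtremalSources vmin vmax)
    {T : B.Path → B.Path} (hT : B.IsVershik T) : Continuous T := by
  refine continuous_iff_continuousAt.2 fun x U hU => mem_map.2 ?_
  by_cases hx : ∀ i, (x.1 i).IsMax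
  · obtain ⟨N, hN⟩ := h.eventually_of_mem_nhds (hT.1 x hx) hU
    refine mem_of_superset ((isClopen_cyl x N).isOpen.mem_nhds (mem_cyl_self x N)) fun y hy => ?_
    refine hN _ fun i hi => ?_
    by_cases hy' : ∀ i, (y.1 i).IsMax
    · exact hT.1 y hy' i
    · obtain ⟨k, hk, hk'⟩ := exists_first_not hy'
      refine (hT.2 y k hk hk').1 i (hi.trans_le ?_)
      by_contra hkN
      exact hk' (by rw [hy k (by omega)]; exact hx k)
  · obtain ⟨k, hk, hk'⟩ := exists_first_not hx
    obtain ⟨V, hVU, hV, hxV⟩ := mem_nhds_iff.1 hU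
    obtain ⟨n, hn⟩ := exists_cyl_subset hV hxV
    refine mem_of_superset ((isClopen_cyl x (n + k + 1)).isOpen.mem_nhds (mem_cyl_self x _))
      fun y hy => hVU (hn fun i hi => ?_)
    obtain ⟨h1, h2, h3, h4⟩ := hT.2 x k hk hk'
    have hyx : ∀ i ≤ k, y.1 i = x.1 i := fun i hi => hy i (by omega)
    have hky : ∀ i < k, (y.1 i).IsMax := fun i hi => by rw [hyx i hi.le]; exact hk i hi
    have hky' : ¬ (y.1 k).IsMax := by rwa [hyx k le_rfl]
    obtain ⟨g1, g2, g3, g4⟩ := hT.2 y k hky hky'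
    rw [hyx k le_rfl] at g2 g3
    have hkk : (T y).1 k = (T x).1 k :=
      Edge.eq_of_target_pos (g2.trans h2.symm) (g3.trans h3.symm)
    rcases lt_trichotomy i k with hik | rfl | hik
    · refine eq_of_rank_eq (n := k) (by rw [hkk]) ?_ i hik
      rw [rank_eq_zero_of_isMin g1, rank_eq_zero_of_isMin h1]
    · exact hkk
    · rw [g4 i hik, h4 i hik, hy i (by omega)]

theorem HasExtremalSources.exists_homeomorph (hB : B.IsBratteli)
    (h : B.HasExtremalSources vmin vmax) : ∃ T : B.Path ≃ₜ B.Path, B.IsVershik T := by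
  have hP := h.isProper hB
  have := compactSpace_path hB
  obtain ⟨T, hT⟩ := exists_isVershik hB hP
  have hc : Continuous (Equiv.ofBijective T ⟨hT.injective hP, hT.surjective hB hP⟩) :=
    h.continuous hT
  exact ⟨hc.homeoOfEquivCompactToT2, hT⟩

/-! #### Connected levels: the Cantor property and minimality -/

/-- Two paths with the same end are in the same orbit. -/
theorem IsVershik.exists_zpow_eq {T : B.Path ≃ₜ B.Path} (hT : B.IsVershik T) {x y : B.Path} {n : ℕ}
    (h : ∀ i ≥ n, x.1 i = y.1 i) : ∃ m : ℤ, (T ^ m) x = y := by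
  have pow : ∀ (m : ℕ) (z : B.Path), (T ^ m) z = T^[m] z := by
    intro m
    induction m with
    | zero => exact fun z => rfl
    | succ m ih =>
      intro z
      rw [pow_succ, Function.iterate_succ_apply, ← ih]
      rfl
  rcases le_total (rank x n) (rank y n) with hr | hr
  · exact ⟨(rank y n - rank x n : ℕ), by rw [zpow_natCast, pow, hT.iterate_eq h hr]⟩
  · refine ⟨-(rank x n - rank y n : ℕ), ?_⟩
    rw [zpow_neg, zpow_natCast]
    refine (T ^ (rank x n - rank y n)).symm_apply_eq.2 ?_
    rw [pow, hT.iterate_eq (fun i hi => (h i hi).symm) hr]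

theorem exists_path_glue (x y : B.Path) {n : ℕ} {e : B.Edge n} (hs : e.source = (x.1 n).source)
    (ht : e.target = (y.1 n).target) :
    ∃ z : B.Path, (∀ i < n, z.1 i = x.1 i) ∧ z.1 n = e ∧ ∀ i > n, z.1 i = y.1 i := by
  refine ⟨⟨fun i => if i < n then x.1 i else if h : n = i then h ▸ e else y.1 i, fun i => ?_⟩,
    fun i hi => by simp [hi], by simp, fun i hi => by simp [hi.not_gt, hi.ne]⟩
  rcases lt_trichotomy (i + 1) n with h | rfl | h
  · simpa [h, (Nat.lt_succ_self i).trans h] using x.2 i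
  · simpa [hs] using x.2 i
  · rcases Nat.eq_or_lt_of_le (Nat.le_of_lt_succ h) with rfl | h'
    · simpa [ht] using y.2 n
    · simpa [h.not_gt, h'.not_gt, h.ne, h'.ne] using y.2 i

/-- Orbits contain all paths with the same tail, and full connection between levels allows any
initial segment to be glued to any tail. -/
theorem IsVershik.isMinimalHomeo {T : B.Path ≃ₜ B.Path} (hT : B.IsVershik T)
    (hconn : ∀ n ≥ 1, ∀ (i : B.V n) (j : B.V (n + 1)), ∃ o, B.src n j o = i) :
    IsMinimalHomeo T := by
  intro y
  refine isTopologicalBasis_cyl.dense_iff.2 ?_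
  rintro _ ⟨⟨x, n⟩, rfl⟩ -
  obtain ⟨o, ho⟩ := hconn (n + 1) (by omega) (x.1 (n + 1)).source (y.1 (n + 1)).target
  obtain ⟨z, hz, hz', hz''⟩ := exists_path_glue x y (e := ⟨_, o⟩) ho rfl
  obtain ⟨m, hm⟩ := hT.exists_zpow_eq (x := y) (y := z) (n := n + 2)
    fun i hi => (hz'' i hi).symm
  exact ⟨z, fun i hi => hz i (by dsimp only at hi; omega), m, hm⟩

theorem isCantorSpace_path (hB : B.IsBratteli) (hne : Nonempty B.Path)
    (hconn : ∀ n ≥ 1, ∀ (i : B.V n) (j : B.V (n + 1)), ∃ o, B.src n j o = i)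
    (hcard : ∀ n ≥ 1, Nontrivial (B.V n)) : IsCantorSpace B.Path := by
  have hco := compactSpace_path hB
  refine ⟨hne, hco, inferInstance, ⟨_, countable_cyl hB, isTopologicalBasis_cyl, ?_⟩,
    fun x hx => ?_⟩
  · rintro _ ⟨p, rfl⟩
    exact isClopen_cyl _ _
  · obtain ⟨n, hn⟩ := exists_cyl_subset hx rfl
    have := hcard (n + 1 + 1) (by omega)
    obtain ⟨j, hj⟩ := exists_ne (x.1 (n + 1)).target
    obtain ⟨o, ho⟩ := hconn (n + 1) (by omega) (x.1 (n + 1)).source j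
    have hsrc : ∀ n, ∀ i : B.V n, ∃ e : B.Edge n, e.source = i := fun n i =>
      let ⟨j, o, h⟩ := hB.src_surj n i
      ⟨⟨j, o⟩, h⟩
    choose g hg using hsrc
    let e : B.Edge (n + 1) := ⟨j, o⟩
    -- An open singleton would contain a cylinder; leaving x along `e` towards another vertex
    -- contradicts this, provided `e` has a continuation. It is built recursively in `f` from edges
    -- leaving the current target; `F` reindexes it by absolute levels, and its values below level n
    -- + 1 are placeholders.
    have hy : ∃ y : B.Path, y.1 (n + 1) = e := by
      let f : ∀ i, B.Edge (n + 1 + i) := fun i =>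
        Nat.rec e (fun i e' => g (n + 1 + i + 1) e'.target) i
      let F : ∀ i, B.Edge i := fun i =>
        if h : n + 1 ≤ i then (Nat.add_sub_cancel' h) ▸ f (i - (n + 1)) else
          g i (x.1 i).source
      have hF : ∀ i, F (n + 1 + i) = f i := by
        intro i
        have : ∀ k (hk : n + 1 + k = n + 1 + i), hk ▸ f k = f i := by
          intro k hk
          obtain rfl : k = i := by omega
          rfl
        simp only [F, dif_pos (Nat.le_add_right (n + 1) i)]
        exact this _ _
      obtain ⟨y, hy, -⟩ := exists_path_of_tail _ (exists_isMin hB) (n + 1) F (by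
        intro i hi
        obtain ⟨k, rfl⟩ := Nat.exists_eq_add_of_le hi
        rw [hF]
        refine Eq.trans ?_ (congrArg Edge.source (hF (k + 1))).symm
        exact (hg _ _).symm)
      exact ⟨y, (hy (n + 1) le_rfl).trans (hF 0)⟩
    obtain ⟨y, hy⟩ := hy
    obtain ⟨z, hz, hz', -⟩ := exists_path_glue x y (e := e) ho (by rw [hy])
    have : z = x := hn fun i hi => hz i (by omega)
    rw [this] at hz'
    exact hj (by rw [hz']; rfl)

/-! #### Levels of the towers -/

/-- The floor number `r` of the tower over the vertex `j` of level `n`. -/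
def floor (n : ℕ) (j : B.V n) (r : ℕ) : Set B.Path := {x | (x.1 n).source = j ∧ rank x n = r}

theorem floor_eq_cyl (x : B.Path) (n : ℕ) :
    floor (n + 1) (x.1 (n + 1)).source (rank x (n + 1)) = cyl x (n + 1) := by
  ext y
  refine ⟨fun h => eq_of_rank_eq h.1 h.2, fun h => ⟨?_, rank_congr h⟩⟩
  rw [← y.2, ← x.2, h n (by omega)]

theorem isClopen_source (n : ℕ) (s : Set (B.V n)) : IsClopen {x : B.Path | (x.1 n).source ∈ s} :=
  (isClopen_discrete (Edge.source ⁻¹' s)).preimage (continuous_coord n)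

theorem continuous_rank (n : ℕ) : Continuous fun x : B.Path => rank x n := by
  refine (IsLocallyConstant.iff_exists_open _).2 (fun x => ?_) |>.continuous
  exact ⟨cyl x n, (isClopen_cyl x n).isOpen, mem_cyl_self x n, fun y hy => rank_congr hy⟩

theorem measurableSet_floor (n : ℕ) (j : B.V n) (r : ℕ) : MeasurableSet (floor n j r) :=
  ((isClopen_source n {j}).inter
    ((isClopen_discrete {r}).preimage (continuous_rank n))).isOpen.measurableSet

theorem IsVershik.preimage_floor_succ {T : B.Path → B.Path}
    (hT : B.IsVershik T) {n : ℕ} {j : B.V n} {r : ℕ} (hr : r + 1 < B.height n j) :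
    T ⁻¹' floor n j (r + 1) = floor n j r := by
  ext x
  by_cases hx : ∀ i < n, (x.1 i).IsMax
  · refine ⟨fun h => ?_, fun h => ?_⟩
    · have := hT.rank_apply_of_isMax hx
      have := h.2
      omega
    · have h1 := rank_add_one_of_isMax hx
      rw [h.1, h.2] at h1
      omega
  · have h1 := hT.rank_apply hx
    have h2 : ((T x).1 n).source = (x.1 n).source :=
      source_eq_of_eq_ge (hT.apply_eq_of_not_isMax hx)
    simp [floor, h1, h2]

theorem IsVershik.measureReal_floor {T : B.Path → B.Path}
    (hT : B.IsVershik T) {μ : Measure B.Path} (hμ : MeasurePreserving T μ μ) {n : ℕ} {j : B.V n}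
    {r : ℕ} (hr : r < B.height n j) : μ.real (floor n j r) = μ.real (floor n j 0) := by
  induction r with
  | zero => rfl
  | succ r ih =>
    rw [← ih (by omega), ← hT.preimage_floor_succ hr, Measure.real, Measure.real,
      hμ.measure_preimage (measurableSet_floor _ _ _).nullMeasurableSet]

/-- Cutting and stacking: the tower over `e.target` is a stack of slices of towers of level n, and
the slice belonging to `e` starts at the partial height. -/
theorem floor_succ_partialHeight {n : ℕ} (e : B.Edge n) {r : ℕ} (hr : r < B.height n e.source) :
    floor (n + 1) e.target (B.partialHeight n e.target e.pos + r) =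
      {x | x.1 n = e ∧ rank x n = r} := by
  ext x
  constructor
  · rintro ⟨h1, h2⟩
    rw [← x.2] at h1
    rw [rank_succ, h1] at h2
    have hlt := rank_lt_height x n
    have key : x.1 n = e := by
      generalize x.1 n = e' at *
      obtain ⟨j, o⟩ := e
      obtain ⟨j', o'⟩ := e'
      obtain rfl : j' = j := h1
      change rank x n + B.partialHeight n j' o' = B.partialHeight n j' o + r at h2
      change rank x n < B.height n (B.src n j' o') at hlt
      change r < B.height n (B.src n j' o) at hr
      rcases lt_trichotomy o o' with h | rfl | h
      · have := partialHeight_lt_height h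
        omega
      · rfl
      · have := partialHeight_lt_height h
        omega
    rw [key] at h2
    exact ⟨key, by omega⟩
  · rintro ⟨rfl, h2⟩
    exact ⟨(x.2 n).symm, by rw [rank_succ, h2, add_comm]⟩

theorem measurableSet_edge {n : ℕ} (E : Set (B.Edge n)) : MeasurableSet {x : B.Path | x.1 n ∈ E} :=
  ((isClopen_discrete E).preimage (continuous_coord n)).isOpen.measurableSet

theorem measurableSet_rank {n : ℕ} (R : Set ℕ) : MeasurableSet {x : B.Path | rank x n ∈ R} :=
  ((isClopen_discrete R).preimage (continuous_rank n)).isOpen.measurableSet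

theorem IsVershik.measureReal_edge_rank {T : B.Path → B.Path}
    (hT : B.IsVershik T) {μ : Measure B.Path} (hμ : MeasurePreserving T μ μ) {n : ℕ}
    (e : B.Edge n) {r : ℕ} (hr : r < B.height n e.source) :
    μ.real {x | x.1 n = e ∧ rank x n = r} = μ.real (floor (n + 1) e.target 0) := by
  rw [← floor_succ_partialHeight e hr, hT.measureReal_floor hμ]
  have := partialHeight_add_height_le e
  omega

theorem IsVershik.measureReal_edge {T : B.Path → B.Path}
    (hT : B.IsVershik T) {μ : Measure B.Path} [IsFiniteMeasure μ] (hμ : MeasurePreserving T μ μ)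
    {n : ℕ} (e : B.Edge n) :
    μ.real {x | x.1 n = e} = B.height n e.source * μ.real (floor (n + 1) e.target 0) := by
  have : {x : B.Path | x.1 n = e} =
      ⋃ r ∈ Finset.range (B.height n e.source), {x : B.Path | x.1 n = e ∧ rank x n = r} := by
    ext x
    simp only [Set.mem_ofPred_eq, Set.mem_iUnion, Finset.mem_range, exists_prop]
    refine ⟨fun h => ⟨rank x n, ?_, h, rfl⟩, fun ⟨r, _, h, _⟩ => h⟩
    rw [← h]
    exact rank_lt_height x n
  rw [this, measureReal_biUnion_finset]
  · rw [Finset.sum_congr rfl fun r hr =>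
      hT.measureReal_edge_rank hμ e (Finset.mem_range.1 hr)]
    simp
  · intro r _ r' _ hne
    exact Set.disjoint_left.2 fun x hx hx' => hne (hx.2.symm.trans hx'.2)
  · exact fun r _ => (measurableSet_edge {e}).inter (measurableSet_rank {r})

end OrderedDiagram

/-! ### Invariant measures -/

section InvariantMeasure

variable {X : Type*} [TopologicalSpace X] [CompactSpace X] [T2Space X] [HasOuterApproxClosed X]
  [MeasurableSpace X] [BorelSpace X]

open scoped BoundedContinuousFunction in
/-- A continuous map of a compact space has an invariant probability measure. -/
theorem exists_invariant_measure [Nonempty X] {T : X → X} (hT : Continuous T) :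
    ∃ μ : Measure X, IsProbabilityMeasure μ ∧ MeasurePreserving T μ μ := by
  obtain ⟨x⟩ := ‹Nonempty X›
  -- Krylov–Bogolyubov: averages of Dirac masses along an orbit. A limit along the hyperfilter
  -- replaces the extraction of a subsequence.
  let ν : ℕ → Measure X := fun N =>
    ((N + 1 : ℕ) : ENNReal)⁻¹ • ∑ i ∈ Finset.range (N + 1), Measure.dirac (T^[i] x)
  have hν : ∀ N, IsProbabilityMeasure (ν N) := fun N => ⟨by
    simp only [ν, Measure.smul_apply, Measure.finsetSum_apply, measure_univ, Finset.sum_const,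
      Finset.card_range, smul_eq_mul, nsmul_eq_mul, mul_one]
    exact ENNReal.inv_mul_cancel (by simp) (ENNReal.natCast_ne_top _)⟩
  let P : ℕ → ProbabilityMeasure X := fun N => ⟨ν N, hν N⟩
  obtain ⟨μ, -, hμ⟩ := isCompact_univ.ultrafilter_le_nhds ((Filter.hyperfilter ℕ).map P) (by simp)
  have hlim : Tendsto P (Filter.hyperfilter ℕ) (𝓝 μ) := hμ
  have hint : ∀ (N : ℕ) (f : X →ᵇ ℝ),
      ∫ y, f y ∂(P N : Measure X) = ((N + 1 : ℕ) : ℝ)⁻¹ *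
        ∑ i ∈ Finset.range (N + 1), f (T^[i] x) := by
    intro N f
    change ∫ y, f y ∂(ν N) = _
    rw [integral_smul_measure, integral_finsetSum_measure fun i _ => f.integrable _,
      ENNReal.toReal_inv, ENNReal.toReal_natCast, smul_eq_mul]
    simp only [integral_dirac]
  refine ⟨μ, μ.2, hT.measurable, ?_⟩
  have : IsProbabilityMeasure (Measure.map T (μ : Measure X)) :=
    Measure.isProbabilityMeasure_map hT.aemeasurable
  refine ext_of_forall_integral_eq_of_IsFiniteMeasure fun f => ?_
  rw [integral_map hT.aemeasurable f.continuous.aestronglyMeasurable]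
  have h1 := ProbabilityMeasure.tendsto_iff_forall_integral_tendsto.1 hlim
  have h2 := (h1 (f.compContinuous ⟨T, hT⟩)).sub (h1 f)
  have h3 : Tendsto (fun N => ∫ y, (f.compContinuous ⟨T, hT⟩) y ∂(P N : Measure X) -
      ∫ y, f y ∂(P N : Measure X)) (Filter.hyperfilter ℕ) (𝓝 0) := by
    have h4 : Tendsto (fun N : ℕ => ((N + 1 : ℕ) : ℝ)⁻¹ * (2 * ‖f‖)) atTop (𝓝 0) := by
      have := ((tendsto_add_atTop_iff_nat 1).2
        (tendsto_inv_atTop_nhds_zero_nat (𝕜 := ℝ))).mul_const (2 * ‖f‖)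
      simpa using this
    refine squeeze_zero_norm (fun N => ?_) (h4.mono_left Nat.hyperfilter_le_atTop)
    rw [hint, hint, ← mul_sub, norm_mul, ← Finset.sum_sub_distrib]
    -- The difference of the two averages telescopes, leaving two boundary terms divided by N + 1.
    have h5 : ∀ i, (f.compContinuous ⟨T, hT⟩) (T^[i] x) - f (T^[i] x) =
        f (T^[i + 1] x) - f (T^[i] x) := fun i => by
      rw [Function.iterate_succ_apply']
      rfl
    simp only [h5]
    rw [Finset.sum_range_sub (fun i => f (T^[i] x)), norm_inv, Real.norm_natCast]
    gcongr
    refine (norm_sub_le _ _).trans ?_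
    linarith [f.norm_coe_le_norm (T^[N + 1] x), f.norm_coe_le_norm (T^[0] x)]
  exact sub_eq_zero.1 (tendsto_nhds_unique h2 h3)

end InvariantMeasure

/-! ### Invariant measures in terms of the bases of the towers -/

namespace OrderedDiagram

variable {B : OrderedDiagram}

/-- The base of the tower over i is cut into the bottoms of the slices of that tower inside the
towers of the next level. Each bottom is a floor there, with the measure of the base. -/
theorem IsVershik.measureReal_base (hB : B.IsBratteli) {T : B.Path → B.Path}
    (hT : B.IsVershik T) {μ : Measure B.Path} [IsFiniteMeasure μ] (hμ : MeasurePreserving T μ μ)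
    (n : ℕ) [Fintype (B.V (n + 1))] (i : B.V n) :
    μ.real (floor n i 0) = ∑ j, (B.incidence n j i : ℝ) * μ.real (floor (n + 1) j 0) := by
  classical
  have h1 : floor n i 0 = ⋃ j ∈ Finset.univ (α := B.V (n + 1)),
      ⋃ o ∈ Finset.univ.filter (fun o : Fin (B.deg n j) => B.src n j o = i),
        {x : B.Path | x.1 n = ⟨j, o⟩ ∧ rank x n = 0} := by
    ext x
    simp only [floor, Set.mem_ofPred_eq, Finset.mem_univ, Finset.mem_filter, true_and,
      Set.mem_iUnion, exists_prop, Set.iUnion_true]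
    constructor
    · rintro ⟨h1, h2⟩
      exact ⟨(x.1 n).1, (x.1 n).2, h1, rfl, h2⟩
    · rintro ⟨j, o, h1, h2, h3⟩
      exact ⟨by rw [h2]; exact h1, h3⟩
  have hm : ∀ (j : B.V (n + 1)) (o : Fin (B.deg n j)),
      MeasurableSet {x : B.Path | x.1 n = ⟨j, o⟩ ∧ rank x n = 0} :=
    fun j o => (measurableSet_edge {(⟨j, o⟩ : B.Edge n)}).inter (measurableSet_rank (n := n) {0})
  rw [h1, measureReal_biUnion_finset ?_ ?_ fun _ _ => measure_ne_top _ _]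
  · refine Finset.sum_congr rfl fun j _ => ?_
    rw [measureReal_biUnion_finset]
    · rw [Finset.sum_congr rfl fun o _ => hT.measureReal_edge_rank hμ (⟨j, o⟩ : B.Edge n)
        (height_pos hB _ _)]
      change ∑ o ∈ _, μ.real (floor (n + 1) j 0) = _
      rw [Finset.sum_const, nsmul_eq_mul, incidence, Nat.card_eq_fintype_card, Fintype.card_subtype]
    · intro o _ o' _ hne
      refine Set.disjoint_left.2 fun x hx hx' => hne ?_
      have := hx.1.symm.trans hx'.1
      simpa using eq_of_heq (Sigma.mk.inj this).2
    · exact fun o _ => hm j o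
  · intro j _ j' _ hne
    refine Set.disjoint_left.2 fun x hx hx' => hne ?_
    simp only [Set.mem_iUnion] at hx hx'
    obtain ⟨o, -, hx⟩ := hx
    obtain ⟨o', -, hx'⟩ := hx'
    exact (Sigma.mk.inj (hx.1.symm.trans hx'.1)).1
  · exact fun j _ => Finset.measurableSet_biUnion _ fun o _ => hm j o

theorem IsVershik.sum_height_mul_measureReal_base {T : B.Path → B.Path}
    (hT : B.IsVershik T) {μ : Measure B.Path} [IsProbabilityMeasure μ]
    (hμ : MeasurePreserving T μ μ) (n : ℕ) [Fintype (B.V n)] :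
    ∑ j, (B.height n j : ℝ) * μ.real (floor n j 0) = 1 := by
  have h1 : (Set.univ : Set B.Path) = ⋃ j ∈ Finset.univ (α := B.V n),
      ⋃ r ∈ Finset.range (B.height n j), floor n j r := by
    symm
    refine Set.eq_univ_of_forall fun x => ?_
    simp only [Set.mem_iUnion, Finset.mem_univ, Finset.mem_range]
    exact ⟨_, trivial, rank x n, rank_lt_height x n, rfl, rfl⟩
  rw [← probReal_univ (μ := μ), h1, measureReal_biUnion_finset ?_ ?_ fun _ _ => measure_ne_top _ _]
  · refine Finset.sum_congr rfl fun j _ => ?_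
    rw [measureReal_biUnion_finset]
    · rw [Finset.sum_congr rfl fun r hr => hT.measureReal_floor hμ (Finset.mem_range.1 hr)]
      simp
    · exact fun r _ r' _ hne => Set.disjoint_left.2 fun x hx hx' => hne (hx.2.symm.trans hx'.2)
    · exact fun r _ => measurableSet_floor _ _ _
  · intro j _ j' _ hne
    refine Set.disjoint_left.2 fun x hx hx' => hne ?_
    simp only [Set.mem_iUnion] at hx hx'
    obtain ⟨o, -, hx⟩ := hx
    obtain ⟨o', -, hx'⟩ := hx'
    exact hx.1.symm.trans hx'.1
  · exact fun j _ => Finset.measurableSet_biUnion _ fun r _ => measurableSet_floor _ _ _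

/-- Cylinders form a π-system and each nontrivial one is a floor, whose measure is that of its base.
-/
theorem IsVershik.measure_eq (hB : B.IsBratteli) {T : B.Path → B.Path} (hT : B.IsVershik T)
    {μ ν : Measure B.Path} [IsProbabilityMeasure μ] [IsProbabilityMeasure ν]
    (hμ : MeasurePreserving T μ μ) (hν : MeasurePreserving T ν ν)
    (h : ∀ n (j : B.V (n + 1)), μ.real (floor (n + 1) j 0) = ν.real (floor (n + 1) j 0)) :
    μ = ν := by
  refine ext_of_generate_finite _ (generateFrom_cyl hB) isPiSystem_cyl ?_ (by simp)
  rintro _ ⟨⟨x, n⟩, rfl⟩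
  cases n with
  | zero =>
    have : cyl x 0 = Set.univ := Set.eq_univ_of_forall fun y i hi => absurd hi (by omega)
    simp [this]
  | succ n =>
    rw [← measureReal_eq_measureReal_iff]
    dsimp only
    rw [← floor_eq_cyl, hT.measureReal_floor hμ (rank_lt_height _ _),
      hT.measureReal_floor hν (rank_lt_height _ _), h]

theorem exists_invariant_measure_path (hB : B.IsBratteli) [Nonempty B.Path] {T : B.Path → B.Path}
    (hT : Continuous T) :
    ∃ μ : Measure B.Path, IsProbabilityMeasure μ ∧ MeasurePreserving T μ μ := by
  have := compactSpace_path hB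
  have := secondCountable_path hB
  -- A metric supplies the outer approximation of closed sets needed for weak limits.
  let := TopologicalSpace.metrizableSpaceMetric B.Path
  exact exists_invariant_measure hT

end OrderedDiagram

namespace FibExample

/-! ### Best orderings -/

section Words

variable {w : Fin 2 → ℝ} {h : Fin 2 → ℕ}

/-- The number `⟨S - h, w⟩` for the sum `S` of the first `m` letters of the best ordering. -/
noncomputable def bestDefect (w : Fin 2 → ℝ) (h : Fin 2 → ℕ) (m : ℕ) : ℝ :=
  ((bestSum w h m 0 : ℝ) - h 0) * w 0 + ((bestSum w h m 1 : ℝ) - h 1) * w 1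

/-- The properties of `w` and `h` that force the best ordering to end in `h`. -/
structure BestPair (w : Fin 2 → ℝ) (h : Fin 2 → ℕ) : Prop where
  neg : w 0 < 0
  pos : 0 < w 1
  le : -w 0 ≤ w 1
  height_pos : ∀ i, 0 < h i
  dot_pos : 0 < h 0 * w 0 + h 1 * w 1

theorem bestLetter_eq_zero_iff (m : ℕ) : bestLetter w h m = 0 ↔ 0 < bestDefect w h m := by
  simp [bestLetter, bestNext, bestDefect, dotProduct, Fin.sum_univ_two]

theorem bestLetter_eq_one_iff (m : ℕ) : bestLetter w h m = 1 ↔ bestDefect w h m ≤ 0 := by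
  rw [← not_lt, ← bestLetter_eq_zero_iff]
  generalize bestLetter w h m = i
  fin_cases i <;> simp

theorem bestSum_succ (m : ℕ) (i : Fin 2) :
    bestSum w h (m + 1) i = bestSum w h m i + if bestLetter w h m = i then 1 else 0 := by
  simp [bestSum, bestLetter, Pi.single_apply, eq_comm]

theorem bestSum_succ_of_pos {m : ℕ} (hm : 0 < bestDefect w h m) :
    bestSum w h (m + 1) 0 = bestSum w h m 0 + 1 ∧ bestSum w h (m + 1) 1 = bestSum w h m 1 := by
  simp [bestSum_succ, (bestLetter_eq_zero_iff m).2 hm]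

theorem bestSum_succ_of_nonpos {m : ℕ} (hm : bestDefect w h m ≤ 0) :
    bestSum w h (m + 1) 0 = bestSum w h m 0 ∧ bestSum w h (m + 1) 1 = bestSum w h m 1 + 1 := by
  simp [bestSum_succ, (bestLetter_eq_one_iff m).2 hm]

theorem bestDefect_succ_of_pos {m : ℕ} (hm : 0 < bestDefect w h m) :
    bestDefect w h (m + 1) = bestDefect w h m + w 0 := by
  obtain ⟨h0, h1⟩ := bestSum_succ_of_pos hm
  rw [bestDefect, bestDefect, h0, h1]
  push_cast
  ring

theorem bestDefect_succ_of_nonpos {m : ℕ} (hm : bestDefect w h m ≤ 0) :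
    bestDefect w h (m + 1) = bestDefect w h m + w 1 := by
  obtain ⟨h0, h1⟩ := bestSum_succ_of_nonpos hm
  rw [bestDefect, bestDefect, h0, h1]
  push_cast
  ring

theorem bestDefect_zero : bestDefect w h 0 = -(h 0 * w 0 + h 1 * w 1) := by
  simp [bestDefect, bestSum]
  ring

theorem bestSum_add (m : ℕ) : bestSum w h m 0 + bestSum w h m 1 = m := by
  induction m with
  | zero => simp [bestSum]
  | succ m ih =>
    rcases lt_or_ge 0 (bestDefect w h m) with hm | hm
    · have := bestSum_succ_of_pos hm
      omega
    · have := bestSum_succ_of_nonpos hm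
      omega

theorem card_bestLetter (m : ℕ) (i : Fin 2) :
    (Finset.univ.filter fun o : Fin m => bestLetter w h o = i).card = bestSum w h m i := by
  induction m with
  | zero => simp [bestSum]
  | succ m ih =>
    rw [bestSum_succ, ← ih, Finset.card_filter, Finset.card_filter, Fin.sum_univ_castSucc]
    simp

variable (hw : BestPair w h)
include hw

/-- The ordering cannot overshoot h: when the letter `0` is used up, the defect is nonpositive and
`1` is chosen; when `1` is used up and some `0` remains, the defect is positive because `w 0 < 0`.
-/
theorem BestPair.bestSum_le {m : ℕ} (hm : m ≤ h 0 + h 1) :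
    bestSum w h m 0 ≤ h 0 ∧ bestSum w h m 1 ≤ h 1 := by
  induction m with
  | zero => simp [bestSum]
  | succ m ih =>
    obtain ⟨h0, h1⟩ := ih (by omega)
    have hadd := bestSum_add (w := w) (h := h) m
    have h0' : (bestSum w h m 0 : ℝ) ≤ h 0 := by exact_mod_cast h0
    have h1' : (bestSum w h m 1 : ℝ) ≤ h 1 := by exact_mod_cast h1
    rcases lt_or_ge 0 (bestDefect w h m) with hd | hd
    · have hs := bestSum_succ_of_pos hd
      have : bestSum w h m 0 ≠ h 0 := by
        intro he
        rw [bestDefect, he] at hd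
        nlinarith [hw.pos]
      omega
    · have hs := bestSum_succ_of_nonpos hd
      have : bestSum w h m 1 ≠ h 1 := by
        intro he
        have hlt : bestSum w h m 0 < h 0 := by omega
        have hlt' : (bestSum w h m 0 : ℝ) < h 0 := by exact_mod_cast hlt
        rw [bestDefect, he] at hd
        nlinarith [hw.neg]
      omega

theorem BestPair.bestSum_eq (i : Fin 2) : bestSum w h (h 0 + h 1) i = h i := by
  have h1 := hw.bestSum_le le_rfl
  have h2 := bestSum_add (w := w) (h := h) (h 0 + h 1)
  fin_cases i <;> simp only [Fin.mk_zero, Fin.mk_one] <;> omega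

theorem BestPair.bestDefect_le (m : ℕ) : bestDefect w h m ≤ w 1 := by
  induction m with
  | zero =>
    rw [bestDefect_zero]
    linarith [hw.dot_pos, hw.pos]
  | succ m ih =>
    rcases lt_or_ge 0 (bestDefect w h m) with hd | hd
    · rw [bestDefect_succ_of_pos hd]
      linarith [hw.neg]
    · rw [bestDefect_succ_of_nonpos hd]
      linarith

/-- The defect decreases only from a positive value and only by `-w 0`, so once the letter `0` has
occurred it stays above `w 0`. -/
theorem BestPair.initial_or_lt (m : ℕ) :
    (bestSum w h m 0 = 0 ∧ bestSum w h m 1 = m) ∨ w 0 < bestDefect w h m := by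
  induction m with
  | zero => simp [bestSum]
  | succ m ih =>
    rcases lt_or_ge 0 (bestDefect w h m) with hd | hd
    · rw [bestDefect_succ_of_pos hd]
      exact Or.inr (by linarith)
    · rw [bestDefect_succ_of_nonpos hd]
      have := bestSum_succ_of_nonpos hd
      exact ih.imp (fun h => ⟨by omega, by omega⟩) fun h => by linarith [hw.pos]

theorem BestPair.bestLetter_first : bestLetter w h 0 = 1 := by
  rw [bestLetter_eq_one_iff, bestDefect_zero]
  linarith [hw.dot_pos]

/-- The final defect is 0. A last letter `1` would put the previous defect at `-w 1 ≤ w 0`, possible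
only within the initial block; then `0` would never occur, against `h 0 > 0`. -/
theorem BestPair.bestLetter_last {m : ℕ} (hm : m + 1 = h 0 + h 1) : bestLetter w h m = 0 := by
  rw [bestLetter_eq_zero_iff]
  by_contra hd
  have hd := not_lt.1 hd
  have hs := bestSum_succ_of_nonpos hd
  have h0 := hw.bestSum_eq 0
  have h1 := hw.bestSum_eq 1
  rw [← hm] at h0 h1
  have h2 := bestDefect_succ_of_nonpos hd
  have h3 : bestDefect w h (m + 1) = 0 := by simp [bestDefect, h0, h1]
  rcases hw.initial_or_lt m with h4 | h4
  · have := hw.height_pos 0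
    omega
  · linarith [hw.le]

/-- The best ordering begins with a block of letters `1 : Fin 2`. -/
theorem BestPair.bestSum_initial {m : ℕ} (hm : m * w 1 ≤ h 0 * w 0 + h 1 * w 1) :
    bestSum w h m 0 = 0 ∧ bestSum w h m 1 = m := by
  induction m with
  | zero => simp [bestSum]
  | succ m ih =>
    push_cast at hm
    obtain ⟨h0, h1⟩ := ih (by linarith [hw.pos])
    have hd : bestDefect w h m ≤ 0 := by
      rw [bestDefect, h0, h1]
      push_cast
      linarith [hw.pos]
    have := bestSum_succ_of_nonpos hd
    omega

/-- The indices at which the defect is large are few. -/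
theorem BestPair.lt_of_lt_abs_bestDefect {m : ℕ} (hm : w 1 < |bestDefect w h m|) :
    m * w 1 < h 0 * w 0 + h 1 * w 1 := by
  have h1 := hw.bestDefect_le m
  have h2 : bestDefect w h m ≤ w 0 := by
    by_contra hlt
    exact hm.not_ge (abs_le.2 ⟨by linarith [hw.le], h1⟩)
  obtain ⟨h3, h4⟩ := (hw.initial_or_lt m).resolve_right (not_lt.2 h2)
  rw [bestDefect, h3, h4] at h2
  push_cast at h2
  linarith [hw.neg]

end Words

/-! ### The matrix `A` -/

local notation "φ" => Real.goldenRatio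

/-- The normalizing factor of the eigenvectors. -/
noncomputable def normFactor : ℝ := (Real.sqrt (1 + φ ^ 2))⁻¹

theorem normFactor_pos : 0 < normFactor := by
  have := Real.goldenRatio_pos
  unfold normFactor
  positivity

theorem normFactor_sq : normFactor ^ 2 * (1 + φ ^ 2) = 1 := by
  have := Real.goldenRatio_pos
  rw [normFactor, inv_pow, Real.sq_sqrt (by positivity)]
  exact inv_mul_cancel₀ (by positivity)

theorem normFactor_mul_goldenRatio_lt_one : normFactor * φ < 1 := by
  have := Real.goldenRatio_pos
  have := normFactor_pos
  have := normFactor_sq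
  nlinarith [mul_pos normFactor_pos Real.goldenRatio_pos]

theorem normFactor_lt_one : normFactor < 1 := by
  have := Real.one_lt_goldenRatio
  have := normFactor_mul_goldenRatio_lt_one
  nlinarith [normFactor_pos]

theorem eU_zero : eU 0 = normFactor * φ := by simp [eU, normFactor]
theorem eU_one : eU 1 = normFactor := by simp [eU, normFactor]
theorem eS_zero : eS 0 = -normFactor := by simp [eS, normFactor]
theorem eS_one : eS 1 = normFactor * φ := by simp [eS, normFactor]

theorem inv_goldenRatio_eq : φ⁻¹ = φ - 1 := by
  refine inv_eq_of_mul_eq_one_right ?_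
  linear_combination Real.goldenRatio_sq

theorem inv_goldenRatio_pos : 0 < φ⁻¹ := inv_pos.2 Real.goldenRatio_pos

theorem inv_goldenRatio_lt_one : φ⁻¹ < 1 := inv_lt_one_of_one_lt₀ Real.one_lt_goldenRatio

/-- The component of `x` along `e_u`. -/
noncomputable def coordU (x : Fin 2 → ℝ) : ℝ := normFactor * (φ * x 0 + x 1)

/-- The component of `x` along `e_s`. -/
noncomputable def coordS (x : Fin 2 → ℝ) : ℝ := normFactor * (-x 0 + φ * x 1)

theorem coordU_combo (a b : ℝ) : coordU (a • eU + b • eS) = a := by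
  simp only [coordU, Pi.add_apply, Pi.smul_apply, smul_eq_mul, eU_zero, eU_one, eS_zero, eS_one]
  linear_combination a * normFactor_sq

theorem coordS_combo (a b : ℝ) : coordS (a • eU + b • eS) = b := by
  simp only [coordS, Pi.add_apply, Pi.smul_apply, smul_eq_mul, eU_zero, eU_one, eS_zero, eS_one]
  linear_combination b * normFactor_sq

theorem eq_combo (x : Fin 2 → ℝ) : x = coordU x • eU + coordS x • eS := by
  ext i
  fin_cases i
  · simp [coordU, coordS, eU_zero, eS_zero]
    linear_combination (-x 0) * normFactor_sq
  · simp [coordU, coordS, eU_one, eS_one]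
    linear_combination (-x 1) * normFactor_sq

theorem fibMatrix_mulVec (x : Fin 2 → ℝ) : fibMatrix ℝ *ᵥ x = ![x 0 + x 1, x 0] := by
  ext i
  fin_cases i <;> simp [fibMatrix, Matrix.mulVec, dotProduct, Fin.sum_univ_two]

theorem coordU_pow_mulVec (k : ℕ) (x : Fin 2 → ℝ) :
    coordU ((fibMatrix ℝ ^ k) *ᵥ x) = φ ^ k * coordU x := by
  induction k with
  | zero => simp
  | succ k ih =>
    rw [pow_succ' (fibMatrix ℝ), ← Matrix.mulVec_mulVec, fibMatrix_mulVec, pow_succ', mul_assoc,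
      ← ih]
    generalize (fibMatrix ℝ ^ k) *ᵥ x = y
    simp [coordU]
    linear_combination (-normFactor * y 0) * Real.goldenRatio_sq

theorem coordS_pow_mulVec (k : ℕ) (x : Fin 2 → ℝ) :
    coordS ((fibMatrix ℝ ^ k) *ᵥ x) = (-φ⁻¹) ^ k * coordS x := by
  induction k with
  | zero => simp
  | succ k ih =>
    rw [pow_succ' (fibMatrix ℝ), ← Matrix.mulVec_mulVec, fibMatrix_mulVec, pow_succ', mul_assoc,
      ← ih]
    generalize (fibMatrix ℝ ^ k) *ᵥ x = y
    rw [inv_goldenRatio_eq]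
    simp only [coordS, Matrix.cons_val_zero, Matrix.cons_val_one]
    linear_combination (normFactor * y 1) * Real.goldenRatio_sq

theorem fibMatrix_pow_cast (k : ℕ) (i j : Fin 2) :
    (fibMatrix ℝ ^ k) i j = ((fibMatrix ℕ ^ k) i j : ℝ) := by
  have h : (fibMatrix ℕ).map (Nat.castRingHom ℝ) = fibMatrix ℝ := by
    ext i j
    fin_cases i <;> fin_cases j <;> simp [fibMatrix]
  have := congrFun (congrFun (Matrix.map_pow (fibMatrix ℕ) (Nat.castRingHom ℝ) k) i) j
  rw [h] at this
  exact this.symm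

theorem fibMatrix_pow_mulVec_apply (k : ℕ) (x : Fin 2 → ℝ) (j : Fin 2) :
    ((fibMatrix ℝ ^ k) *ᵥ x) j =
      (fibMatrix ℕ ^ k) j 0 * x 0 + (fibMatrix ℕ ^ k) j 1 * x 1 := by
  simp [Matrix.mulVec, dotProduct, Fin.sum_univ_two, fibMatrix_pow_cast]

theorem fibMatrix_pow_symm (k : ℕ) (i j : Fin 2) :
    (fibMatrix ℕ ^ k) i j = (fibMatrix ℕ ^ k) j i := by
  have h : (fibMatrix ℕ)ᵀ = fibMatrix ℕ := by
    ext i j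
    fin_cases i <;> fin_cases j <;> rfl
  have := congrFun (congrFun (Matrix.transpose_pow (fibMatrix ℕ) k) i) j
  rw [h] at this
  exact this.symm

/-- Powers of `A` preserve `ℤ²`. -/
theorem exists_int_pow_mulVec (k : ℕ) (z : Fin 2 → ℤ) :
    ∃ z' : Fin 2 → ℤ, (fibMatrix ℝ ^ k) *ᵥ (fun i => (z i : ℝ)) = fun i => (z' i : ℝ) :=
  ⟨fun j => (fibMatrix ℕ ^ k) j 0 * z 0 + (fibMatrix ℕ ^ k) j 1 * z 1, by
    ext j
    rw [fibMatrix_pow_mulVec_apply]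
    push_cast
    rfl⟩

end FibExample

namespace FibExample

/-! ### The diagram of the best orderings -/

section Diagram

open OrderedDiagram

variable {k : ℕ → ℕ} {w : ℕ → Fin 2 → ℝ}

/-- The vertex `i` of a positive level, as a vertex of the diagram. -/
abbrev vertex (k : ℕ → ℕ) (w : ℕ → Fin 2 → ℝ) (n : ℕ) (i : Fin 2) :
    (bestDiagram k w).V (n + 1) := i

theorem deg_vertex (n : ℕ) (j : Fin 2) :
    (bestDiagram k w).deg (n + 1) (vertex k w (n + 1) j) =
      (fibMatrix ℕ ^ k (n + 2)) j 0 + (fibMatrix ℕ ^ k (n + 2)) j 1 :=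
  Fin.sum_univ_two (f := (fibMatrix ℕ ^ k (n + 2)) j)

theorem src_vertex (n : ℕ) (j : Fin 2)
    (o : Fin ((bestDiagram k w).deg (n + 1) (vertex k w (n + 1) j))) :
    (bestDiagram k w).src (n + 1) (vertex k w (n + 1) j) o =
      vertex k w n (bestLetter (w (n + 1)) ((fibMatrix ℕ ^ k (n + 2)) j) o) := rfl

theorem height_one (j : Fin 2) : (bestDiagram k w).height 1 (vertex k w 0 j) = 1 := by
  change ∑ o : Fin 1, 1 = 1
  simp

theorem partialHeight_vertex (n : ℕ) (j : Fin 2) {m : ℕ}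
    (hm : m ≤ (bestDiagram k w).deg (n + 1) (vertex k w (n + 1) j)) :
    (bestDiagram k w).partialHeight (n + 1) (vertex k w (n + 1) j) m =
      bestSum (w (n + 1)) ((fibMatrix ℕ ^ k (n + 2)) j) m 0 *
          (bestDiagram k w).height (n + 1) (vertex k w n 0) +
        bestSum (w (n + 1)) ((fibMatrix ℕ ^ k (n + 2)) j) m 1 *
          (bestDiagram k w).height (n + 1) (vertex k w n 1) := by
  induction m with
  | zero => simp [bestSum]
  | succ m ih =>
    have h1 := partialHeight_succ (B := bestDiagram k w) (n := n + 1) (j := vertex k w (n + 1) j)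
      ⟨m, hm⟩
    rw [src_vertex] at h1
    change _ = _ + (bestDiagram k w).height (n + 1)
      (vertex k w n (bestLetter (w (n + 1)) ((fibMatrix ℕ ^ k (n + 2)) j) m)) at h1
    rw [ih (by omega)] at h1
    refine h1.trans ?_
    rw [bestSum_succ, bestSum_succ]
    rcases Fin.exists_fin_two.1
      ⟨bestLetter (w (n + 1)) ((fibMatrix ℕ ^ k (n + 2)) j) m, rfl⟩ with h | h
    · rw [h]
      simp
      ring
    · rw [h]
      simp
      ring

variable (H : ∀ n j, BestPair (w (n + 1)) ((fibMatrix ℕ ^ k (n + 2)) j))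
include H

theorem height_succ_vertex (n : ℕ) (j : Fin 2) :
    (bestDiagram k w).height (n + 2) (vertex k w (n + 1) j) =
      (fibMatrix ℕ ^ k (n + 2)) j 0 * (bestDiagram k w).height (n + 1) (vertex k w n 0) +
        (fibMatrix ℕ ^ k (n + 2)) j 1 * (bestDiagram k w).height (n + 1) (vertex k w n 1) := by
  rw [← partialHeight_deg, partialHeight_vertex n j le_rfl, deg_vertex, (H n j).bestSum_eq,
    (H n j).bestSum_eq]

theorem incidence_vertex (n : ℕ) (j i : Fin 2) :
    (bestDiagram k w).incidence (n + 1) (vertex k w (n + 1) j) (vertex k w n i) =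
      (fibMatrix ℕ ^ k (n + 2)) j i := by
  have h : (Finset.univ.filter fun o : Fin (∑ i, (fibMatrix ℕ ^ k (n + 2)) j i) =>
      bestLetter (w (n + 1)) ((fibMatrix ℕ ^ k (n + 2)) j) o = i).card =
        (fibMatrix ℕ ^ k (n + 2)) j i := by
    rw [card_bestLetter, Fin.sum_univ_two, (H n j).bestSum_eq]
  rw [← Fintype.card_subtype, ← Nat.card_eq_fintype_card] at h
  exact h

theorem exists_src_eq (n : ℕ) (j i : Fin 2) :
    ∃ o, (bestDiagram k w).src (n + 1) (vertex k w (n + 1) j) o = vertex k w n i := by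
  by_contra hne
  have h1 : IsEmpty {o // (bestDiagram k w).src (n + 1) (vertex k w (n + 1) j) o =
      vertex k w n i} := ⟨fun o => hne ⟨o.1, o.2⟩⟩
  have h2 := incidence_vertex H n j i
  rw [incidence, Nat.card_of_isEmpty] at h2
  exact ((H n j).height_pos i).ne h2

theorem isBratteli_bestDiagram : (bestDiagram k w).IsBratteli where
  finite_V
    | 0 => inferInstanceAs (Finite Unit)
    | n + 1 => inferInstanceAs (Finite (Fin 2))
  card_root := Nat.card_unique (α := Unit)
  deg_pos
    | 0, _ => Nat.one_pos
    | n + 1, j => by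
      have h1 := deg_vertex (k := k) (w := w) n j
      have h2 := (H n j).height_pos 0
      change 0 < (bestDiagram k w).deg (n + 1) (vertex k w (n + 1) j)
      omega
  src_surj
    | 0, _ => ⟨(0 : Fin 2), (0 : Fin 1), rfl⟩
    | n + 1, i => ⟨(0 : Fin 2), exists_src_eq H n 0 i⟩

theorem connected_bestDiagram : ∀ n ≥ 1, ∀ (i : (bestDiagram k w).V n)
    (j : (bestDiagram k w).V (n + 1)), ∃ o, (bestDiagram k w).src n j o = i
  | n + 1, _, i, j => exists_src_eq H n j i

theorem hasExtremalSources_bestDiagram :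
    ∃ vmin vmax, (bestDiagram k w).HasExtremalSources vmin vmax := by
  let v : Fin 2 → ∀ n, (bestDiagram k w).V n := fun i n =>
    match n with
    | 0 => ()
    | n + 1 => vertex k w n i
  refine ⟨v 1, v 0, ?_, ?_⟩
  · rintro (_ | n) ⟨j, o⟩ h
    · rfl
    · have h0 : o.1 = 0 := h
      have : bestLetter (w (n + 1)) ((fibMatrix ℕ ^ k (n + 2)) j) o.1 = 1 := by
        rw [h0]
        exact (H n j).bestLetter_first
      exact this
  · rintro (_ | n) ⟨j, o⟩ h
    · rfl
    · have h0 : o.1 + 1 = _ := Eq.trans h (deg_vertex n j)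
      exact (H n j).bestLetter_last h0

omit H in
theorem nontrivial_vertex : ∀ n ≥ 1, Nontrivial ((bestDiagram k w).V n)
  | _ + 1, _ => inferInstanceAs (Nontrivial (Fin 2))

omit H in
theorem card_vertex_le : ∀ n ≥ 1, Nat.card ((bestDiagram k w).V n) ≤ 2
  | _ + 1, _ => (Nat.card_eq_fintype_card (α := Fin 2)).trans_le (by simp)

end Diagram

end FibExample

namespace FibExample

local notation "φ" => Real.goldenRatio

/-! ### The vectors `w n` and the multiples `α H(n)` -/

theorem cumSum_one (k : ℕ → ℕ) : cumSum k 1 = 0 := by simp [cumSum]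

theorem cumSum_succ (k : ℕ → ℕ) (n : ℕ) : cumSum k (n + 2) = cumSum k (n + 1) + k (n + 2) :=
  Finset.sum_Icc_succ_top (by omega) k

theorem zero_apply_eq (x : Fin 2 → ℝ) : x 0 = normFactor * (φ * coordU x - coordS x) := by
  simp only [coordU, coordS]
  linear_combination (-x 0) * normFactor_sq

theorem one_apply_eq (x : Fin 2 → ℝ) : x 1 = normFactor * (coordU x + φ * coordS x) := by
  simp only [coordU, coordS]
  linear_combination (-x 1) * normFactor_sq

namespace Construction

variable {ε δ : ℕ → ℝ} {v₁ : ℝ} (hpar : IsParameter ε δ v₁) (D : Construction ε δ v₁)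

/-- The component of `w n` along `e_s`. -/
noncomputable def vw (n : ℕ) : ℝ := D.v n + φ⁻¹ ^ cumSum D.k n * (D.t - v₁)

theorem coordU_w (n : ℕ) : coordU (D.w n) = D.u n := coordU_combo _ _

theorem coordS_w (n : ℕ) : coordS (D.w n) = D.vw n := coordS_combo _ _

theorem w_zero (n : ℕ) : D.w n 0 = normFactor * (φ * D.u n - D.vw n) := by
  rw [zero_apply_eq (D.w n), coordU_w, coordS_w]

theorem w_one (n : ℕ) : D.w n 1 = normFactor * (D.u n + φ * D.vw n) := by
  rw [one_apply_eq (D.w n), coordU_w, coordS_w]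

theorem u_pos {n : ℕ} (hn : 1 ≤ n) : 0 < D.u n := (D.u_mem n hn).1

theorem v_lt_vw (n : ℕ) : D.v n < D.vw n := by
  have h1 := pow_pos inv_goldenRatio_pos (cumSum D.k n)
  have h2 := D.t_gt
  have := mul_pos h1 (sub_pos.2 h2)
  unfold vw
  linarith

theorem vw_pos {n : ℕ} (hn : 1 ≤ n) : 0 < D.vw n := (D.v_mem n hn).1.trans (D.v_lt_vw n)

include hpar in
-- The bound δ_n ≤ φ⁻¹ enters here. Together with v_n < `vw n` it makes `w n 0` negative.
theorem goldenRatio_mul_u_le {n : ℕ} (hn : 1 ≤ n) : φ * D.u n ≤ D.v n := by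
  have h1 := (D.u_mem n hn).2
  have h2 := (hpar.delta_mem n hn).2
  have h3 := (D.v_mem n hn).1
  have h4 : D.u n ≤ φ⁻¹ * D.v n := h1.trans (by gcongr)
  calc φ * D.u n ≤ φ * (φ⁻¹ * D.v n) := by
        have := Real.goldenRatio_pos
        gcongr
    _ = D.v n := by rw [← mul_assoc, mul_inv_cancel₀ Real.goldenRatio_ne_zero, one_mul]

include hpar in
theorem bestPair_w {n : ℕ} (hn : 1 ≤ n) (j : Fin 2) :
    BestPair (D.w n) ((fibMatrix ℕ ^ D.k (n + 1)) j) := by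
  have h1 := D.goldenRatio_mul_u_le hpar hn
  have h2 := D.v_lt_vw n
  have h3 := D.u_pos hn
  have h4 := D.vw_pos hn
  have h5 := Real.one_lt_goldenRatio
  obtain ⟨-, hh, hlt⟩ := D.admissible n hn j
  have hneg : D.w n 0 < 0 := by
    rw [w_zero]
    exact mul_neg_of_pos_of_neg normFactor_pos (by linarith)
  have hpos : 0 < D.w n 1 := by
    rw [w_one]
    exact mul_pos normFactor_pos (by positivity)
  refine ⟨hneg, hpos, ?_, hh, ?_⟩
  · rw [w_zero, w_one, ← mul_neg]
    refine mul_le_mul_of_nonneg_left ?_ normFactor_pos.le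
    nlinarith
  · change |D.w n 0| * _ < _ * |D.w n 1| at hlt
    rw [abs_of_neg hneg, abs_of_pos hpos] at hlt
    linarith

include hpar in
theorem bestPair (n : ℕ) (j : Fin 2) :
    BestPair (D.w (n + 1)) ((fibMatrix ℕ ^ D.k (n + 2)) j) := D.bestPair_w hpar (by omega) j

/-- A constant that bounds the entries of `w n` in terms of `ε n`. -/
noncomputable def bound : ℝ := 2 + (D.t - v₁)

include hpar in
theorem abs_w_le (n : ℕ) (i : Fin 2) : |D.w (n + 2) i| ≤ D.bound * ε (n + 2) := by
  have h1 := D.goldenRatio_mul_u_le hpar (n := n + 2) (by omega)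
  have h2 := D.v_lt_vw (n + 2)
  have h3 := D.u_pos (n := n + 2) (by omega)
  have h4 := D.vw_pos (n := n + 2) (by omega)
  have h5 := Real.one_lt_goldenRatio
  have h6 := (D.v_mem (n + 2) (by omega)).2
  -- K_n ≥ k_n, so the condition on the single exponent suffices; it is available only from index 2
  -- on.
  have h7 : φ⁻¹ ^ cumSum D.k (n + 2) ≤ ε (n + 2) := by
    refine le_trans ?_ (D.k_eps (n + 2) (by omega))
    rw [cumSum_succ]
    exact pow_le_pow_of_le_one inv_goldenRatio_pos.le inv_goldenRatio_lt_one.le (by omega)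
  have h8 : D.vw (n + 2) ≤ (1 + (D.t - v₁)) * ε (n + 2) := by
    have := mul_le_mul_of_nonneg_right h7 (sub_pos.2 D.t_gt).le
    unfold vw
    linarith
  have h9 : D.u (n + 2) ≤ ε (n + 2) := by nlinarith
  have hneg := (D.bestPair_w hpar (n := n + 2) (by omega) 0).neg
  have hpos := (D.bestPair_w hpar (n := n + 2) (by omega) 0).pos
  have hle := (D.bestPair_w hpar (n := n + 2) (by omega) 0).le
  -- The coefficients c and cφ are below 1; u contributes at most ε and `vw` at most (1 + t - v₁)ε,
  -- whence the constant 2 + (t - v₁).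
  have h10 : D.w (n + 2) 1 ≤ D.bound * ε (n + 2) := by
    rw [w_one, bound]
    nlinarith [normFactor_lt_one, normFactor_mul_goldenRatio_lt_one]
  match i with
  | 0 => rw [abs_of_neg hneg]; linarith
  | 1 => rwa [abs_of_pos hpos]

include hpar in
theorem tendsto_w (i : Fin 2) : Tendsto (fun n => D.w n i) atTop (𝓝 0) := by
  rw [← tendsto_add_atTop_iff_nat 2]
  refine squeeze_zero_norm (fun n => D.abs_w_le hpar n i) ?_
  have := ((tendsto_add_atTop_iff_nat 2).2 hpar.summable.tendsto_atTop_zero).const_mul D.bound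
  simpa using this

include hpar in
theorem tendsto_u : Tendsto D.u atTop (𝓝 0) := by
  have := (((D.tendsto_w hpar 0).const_mul φ).add (D.tendsto_w hpar 1)).const_mul normFactor
  simp only [mul_zero, add_zero] at this
  exact this.congr fun n => D.coordU_w n

/-- Modulo `ℤ²`, `A ^ k (n + 1)` maps `w n` to `w (n + 1)`. -/
theorem exists_pow_mulVec_w (n : ℕ) : ∃ z : Fin 2 → ℤ,
    (fibMatrix ℝ ^ D.k (n + 2)) *ᵥ D.w (n + 1) = D.w (n + 2) + fun i => (z i : ℝ) := by
  have h1 := D.decomp (n + 1) (by omega) D.t D.t_gt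
  have h2 := D.decomp (n + 2) (by omega) D.t D.t_gt
  rw [cumSum_succ, add_comm, pow_add, ← Matrix.mulVec_mulVec, h1, Matrix.mulVec_add] at h2
  obtain ⟨z, hz⟩ := exists_int_pow_mulVec (D.k (n + 2)) (D.z (n + 1))
  refine ⟨D.z (n + 2) - z, ?_⟩
  rw [hz] at h2
  ext i
  have := congrFun h2 i
  simp only [Pi.add_apply, Pi.sub_apply, Int.cast_sub] at this ⊢
  change _ + ((fibMatrix ℝ ^ D.k (n + 2)) *ᵥ D.w (n + 1)) i = _ + D.w (n + 2) i at this
  linarith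

include hpar in
/-- Modulo `ℤ²`, the vector `w n` is `α H(n)`. -/
theorem exists_alpha_mul_height (n : ℕ) : ∃ z : Fin 2 → ℤ, ∀ j : Fin 2,
    D.α * (D.diagram.height (n + 1) (vertex D.k D.w n j) : ℝ) = D.w (n + 1) j + z j := by
  induction n with
  | zero =>
    have h1 := D.decomp 1 le_rfl D.t D.t_gt
    rw [cumSum_one, pow_zero, Matrix.one_mulVec] at h1
    refine ⟨D.z 1 + ![1, 0], fun j => ?_⟩
    have h2 : D.diagram.height 1 (vertex D.k D.w 0 j) = 1 := height_one j
    rw [h2]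
    have h3 := congrFun D.α_eq j
    have h4 := congrFun h1 j
    change _ = _ + D.w 1 j at h4
    simp only [Pi.add_apply, Pi.smul_apply, smul_eq_mul] at h3 h4 ⊢
    fin_cases j
    · simp at h3 h4 ⊢
      linarith
    · simp at h3 h4 ⊢
      linarith
  | succ n ih =>
    obtain ⟨z, hz⟩ := ih
    obtain ⟨z', hz'⟩ := D.exists_pow_mulVec_w n
    obtain ⟨z'', hz''⟩ := exists_int_pow_mulVec (D.k (n + 2)) z
    refine ⟨z' + z'', fun j => ?_⟩
    have h1 : D.diagram.height (n + 2) (vertex D.k D.w (n + 1) j) = _ :=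
      height_succ_vertex (D.bestPair hpar) n j
    have h2 := congrFun hz' j
    have h3 := congrFun hz'' j
    have h4 := hz 0
    have h5 := hz 1
    rw [fibMatrix_pow_mulVec_apply] at h2 h3
    change D.α * (D.diagram.height (n + 2) (vertex D.k D.w (n + 1) j) : ℝ) = _
    rw [h1]
    simp only [Pi.add_apply] at h2 ⊢
    push_cast
    change _ * (_ * (D.diagram.height (n + 1) (vertex D.k D.w n 0) : ℝ) +
      _ * (D.diagram.height (n + 1) (vertex D.k D.w n 1) : ℝ)) = _
    linear_combination h2 + h3 + ((fibMatrix ℕ ^ D.k (n + 2)) j 0 : ℝ) * h4 +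
      ((fibMatrix ℕ ^ D.k (n + 2)) j 1 : ℝ) * h5

/-- The number `⟨h, w (n + 1)⟩` for the `j`-th row `h` of `A ^ k (n + 2)`. -/
noncomputable def rowDot (n : ℕ) (j : Fin 2) : ℝ :=
  (fibMatrix ℕ ^ D.k (n + 2)) j 0 * D.w (n + 1) 0 + (fibMatrix ℕ ^ D.k (n + 2)) j 1 * D.w (n + 1) 1

theorem exists_rowDot_eq (n : ℕ) : ∃ z : Fin 2 → ℤ, ∀ j, D.rowDot n j = D.w (n + 2) j + z j := by
  obtain ⟨z, hz⟩ := D.exists_pow_mulVec_w n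
  refine ⟨z, fun j => ?_⟩
  rw [rowDot, ← fibMatrix_pow_mulVec_apply, hz]
  rfl

include hpar in
theorem exists_alpha_mul_partialHeight (n : ℕ) (j : Fin 2) {m : ℕ}
    (hm : m ≤ D.diagram.deg (n + 1) (vertex D.k D.w (n + 1) j)) :
    ∃ z : ℤ, D.α * (D.diagram.partialHeight (n + 1) (vertex D.k D.w (n + 1) j) m : ℝ) =
      bestSum (D.w (n + 1)) ((fibMatrix ℕ ^ D.k (n + 2)) j) m 0 * D.w (n + 1) 0 +
        bestSum (D.w (n + 1)) ((fibMatrix ℕ ^ D.k (n + 2)) j) m 1 * D.w (n + 1) 1 + z := by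
  obtain ⟨z, hz⟩ := D.exists_alpha_mul_height hpar n
  refine ⟨bestSum (D.w (n + 1)) ((fibMatrix ℕ ^ D.k (n + 2)) j) m 0 * z 0 +
    bestSum (D.w (n + 1)) ((fibMatrix ℕ ^ D.k (n + 2)) j) m 1 * z 1, ?_⟩
  have h1 : D.diagram.partialHeight (n + 1) (vertex D.k D.w (n + 1) j) m = _ :=
    partialHeight_vertex n j hm
  rw [h1]
  push_cast
  have h4 := hz 0
  have h5 := hz 1
  simp only [diagram] at h4 h5 ⊢
  linear_combination (bestSum (D.w (n + 1)) ((fibMatrix ℕ ^ D.k (n + 2)) j) m 0 : ℝ) * h4 +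
    (bestSum (D.w (n + 1)) ((fibMatrix ℕ ^ D.k (n + 2)) j) m 1 : ℝ) * h5

include hpar in
-- Replacing ⟨S, w_n⟩ by ⟨S - h, w_n⟩ costs ⟨h, w_n⟩, a coordinate of A^{k_{n+1}} w_n, which is
-- congruent to an entry of w_{n+1}. This form is small wherever the defect is; the unshifted form
-- serves on the initial block.
theorem exists_alpha_mul_partialHeight' (n : ℕ) (j : Fin 2) {m : ℕ}
    (hm : m ≤ D.diagram.deg (n + 1) (vertex D.k D.w (n + 1) j)) :
    ∃ z : ℤ, D.α * (D.diagram.partialHeight (n + 1) (vertex D.k D.w (n + 1) j) m : ℝ) =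
      bestDefect (D.w (n + 1)) ((fibMatrix ℕ ^ D.k (n + 2)) j) m + D.w (n + 2) j + z := by
  obtain ⟨z, hz⟩ := D.exists_alpha_mul_partialHeight hpar n j hm
  obtain ⟨z', hz'⟩ := D.exists_rowDot_eq n
  refine ⟨z + z' j, ?_⟩
  have h1 := hz' j
  rw [hz]
  rw [rowDot] at h1
  rw [bestDefect]
  push_cast
  linear_combination h1

/-! ### `α H(m)` is not in `ℤ² + E^s` -/

/-- Powers of A multiply the e_u-component by powers of φ > 1, so a nonzero one cannot tend to 0. -/
theorem coordU_eq_zero_of_mem_stableSpace {s : Fin 2 → ℝ} (hs : s ∈ stableSpace) :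
    coordU s = 0 := by
  have h1 : Tendsto (fun n : ℕ => coordU ((fibMatrix ℝ ^ n) *ᵥ s)) atTop (𝓝 (coordU 0)) := by
    have hc : Continuous coordU := by
      unfold coordU
      fun_prop
    exact (hc.tendsto 0).comp hs
  have h0 : coordU 0 = 0 := by simp [coordU]
  rw [h0] at h1
  by_contra hne
  have h2 : ∀ n : ℕ, |coordU s| ≤ ‖coordU ((fibMatrix ℝ ^ n) *ᵥ s)‖ := by
    intro n
    rw [coordU_pow_mulVec, norm_mul, norm_pow, Real.norm_of_nonneg Real.goldenRatio_pos.le]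
    exact le_mul_of_one_le_left (abs_nonneg _) (one_le_pow₀ Real.one_lt_goldenRatio.le)
  have h3 := ge_of_tendsto' h1.norm h2
  rw [norm_zero] at h3
  exact hne (abs_nonpos_iff.1 h3)

theorem eventually_int_eq_zero {z : ℕ → Fin 2 → ℤ}
    (hz : ∀ i, Tendsto (fun n => (z n i : ℝ)) atTop (𝓝 0)) : ∀ᶠ n in atTop, z n = 0 := by
  have h : ∀ i, ∀ᶠ n in atTop, z n i = 0 := by
    intro i
    filter_upwards [(hz i).eventually (Metric.ball_mem_nhds 0 one_pos)] with n hn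
    rw [Real.dist_eq, sub_zero] at hn
    exact Int.abs_lt_one_iff.1 (by exact_mod_cast hn)
  filter_upwards [h 0, h 1] with n h0 h1
  ext i
  match i with
  | 0 => exact h0
  | 1 => exact h1

include hpar in
theorem alpha_mul_height_not_mem (m : ℕ) : ¬ ∃ (z : Fin 2 → ℤ) (s : Fin 2 → ℝ), s ∈ stableSpace ∧
    (fun j : Fin 2 => D.α * (D.diagram.height (m + 1) (vertex D.k D.w m j) : ℝ)) =
      (fun j => (z j : ℝ)) + s := by
  rintro ⟨z, s, hs, heq⟩
  obtain ⟨z', hz'⟩ := D.exists_alpha_mul_height hpar m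
  -- Both A^p s and w tend to 0, hence so do the integer vectors y, which therefore vanish
  -- eventually. Comparing e_u-components then gives u = 0.
  have key : ∀ n, ∃ (p : ℕ) (y : Fin 2 → ℤ), n ≤ p ∧
      (fibMatrix ℝ ^ p) *ᵥ s = D.w (m + n + 1) + fun i => (y i : ℝ) := by
    intro n
    induction n with
    | zero =>
      refine ⟨0, z' - z, le_rfl, ?_⟩
      ext i
      have h1 := congrFun heq i
      have h2 := hz' i
      simp only [Pi.add_apply] at h1
      simp only [pow_zero, Matrix.one_mulVec, add_zero, Pi.add_apply, Pi.sub_apply, Int.cast_sub]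
      linarith
    | succ n ih =>
      obtain ⟨p, y, hp, hy⟩ := ih
      obtain ⟨y', hy'⟩ := D.exists_pow_mulVec_w (m + n)
      obtain ⟨y'', hy''⟩ := exists_int_pow_mulVec (D.k (m + n + 2)) y
      have hk := D.k_gt (m + n + 2) (by omega)
      refine ⟨D.k (m + n + 2) + p, y' + y'', by omega, ?_⟩
      rw [pow_add, ← Matrix.mulVec_mulVec, hy, Matrix.mulVec_add, hy', hy'']
      ext i
      simp [add_assoc]
  choose p y hp hy using key
  have hp' : Tendsto p atTop atTop := tendsto_atTop_mono hp tendsto_id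
  have h1 : ∀ i, Tendsto (fun n => (y n i : ℝ)) atTop (𝓝 0) := by
    intro i
    have h2 := (tendsto_pi_nhds.1 (Tendsto.comp hs hp') i).sub
      ((tendsto_add_atTop_iff_nat (m + 1)).2 (D.tendsto_w hpar i))
    simp only [Pi.zero_apply, sub_zero] at h2
    refine h2.congr fun n => ?_
    have h3 := congrFun (hy n) i
    simp only [Function.comp_apply, h3, Pi.add_apply]
    rw [show n + (m + 1) = m + n + 1 by ring]
    ring
  obtain ⟨n, hn⟩ := (eventually_int_eq_zero h1).exists
  have h2 := congrArg coordU (hy n)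
  have h3 : (fun i => ((y n i : ℤ) : ℝ)) = 0 := by
    ext i
    simp [hn]
  rw [h3, add_zero, coordU_pow_mulVec, coordU_eq_zero_of_mem_stableSpace hs, mul_zero,
    coordU_w] at h2
  exact (D.u_pos (n := m + n + 1) (by omega)).ne h2

end Construction

end FibExample

namespace FibExample

local notation "φ" => Real.goldenRatio

namespace Construction

open OrderedDiagram

variable {ε δ : ℕ → ℝ} {v₁ : ℝ} (hpar : IsParameter ε δ v₁) (D : Construction ε δ v₁)

/-! ### Invariant measures of the diagram -/

theorem isBratteli (hpar : IsParameter ε δ v₁) : D.diagram.IsBratteli :=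
  isBratteli_bestDiagram (D.bestPair hpar)

instance (n : ℕ) : Fintype (D.diagram.V (n + 1)) := inferInstanceAs (Fintype (Fin 2))

/-- The vertex `i` of a positive level. -/
abbrev vtx (n : ℕ) (i : Fin 2) : D.diagram.V (n + 1) := i

theorem sum_vtx (n : ℕ) (f : D.diagram.V (n + 1) → ℝ) :
    ∑ i, f i = f (D.vtx n 0) + f (D.vtx n 1) := Fin.sum_univ_two (f := f)

/-- The measures of the bases of the two towers of level `n + 1`. -/
noncomputable def baseMeasure (μ : Measure D.diagram.Path) (n : ℕ) (i : Fin 2) : ℝ :=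
  μ.real (floor (n + 1) (D.vtx n i) 0)

variable {T : D.diagram.Path → D.diagram.Path} (hT : D.diagram.IsVershik T)
  {μ : Measure D.diagram.Path} [IsProbabilityMeasure μ] (hμ : MeasurePreserving T μ μ)

omit [IsProbabilityMeasure μ] in
theorem baseMeasure_nonneg (n : ℕ) (i : Fin 2) : 0 ≤ D.baseMeasure μ n i := measureReal_nonneg

theorem baseMeasure_le_one (n : ℕ) (i : Fin 2) : D.baseMeasure μ n i ≤ 1 := measureReal_le_one

include hT hμ

theorem height_mul_baseMeasure (n : ℕ) :
    (D.diagram.height (n + 1) (D.vtx n 0) : ℝ) * D.baseMeasure μ n 0 +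
      (D.diagram.height (n + 1) (D.vtx n 1) : ℝ) * D.baseMeasure μ n 1 = 1 := by
  have := hT.sum_height_mul_measureReal_base hμ (n + 1)
  rwa [sum_vtx] at this

theorem height_mul_baseMeasure_le_one (n : ℕ) (i : Fin 2) :
    (D.diagram.height (n + 1) (D.vtx n i) : ℝ) * D.baseMeasure μ n i ≤ 1 := by
  have h := D.height_mul_baseMeasure hT hμ n
  have h0 := D.baseMeasure_nonneg (μ := μ) n 0
  have h1 := D.baseMeasure_nonneg (μ := μ) n 1
  match i with
  | 0 => nlinarith [mul_nonneg (Nat.cast_nonneg (α := ℝ) (D.diagram.height (n + 1) (D.vtx n 1))) h1]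
  | 1 => nlinarith [mul_nonneg (Nat.cast_nonneg (α := ℝ) (D.diagram.height (n + 1) (D.vtx n 0))) h0]

include hpar

/-- The relation between the bases involves the transposed incidence matrix, but powers of A are
symmetric. -/
theorem baseMeasure_eq_pow_mulVec (n : ℕ) :
    D.baseMeasure μ n = (fibMatrix ℝ ^ D.k (n + 2)) *ᵥ D.baseMeasure μ (n + 1) := by
  ext i
  have h := hT.measureReal_base (D.isBratteli hpar) hμ (n + 1) (D.vtx n i)
  rw [sum_vtx] at h
  have h0 : D.diagram.incidence (n + 1) (D.vtx (n + 1) 0) (D.vtx n i) = _ :=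
    incidence_vertex (D.bestPair hpar) n 0 i
  have h1 : D.diagram.incidence (n + 1) (D.vtx (n + 1) 1) (D.vtx n i) = _ :=
    incidence_vertex (D.bestPair hpar) n 1 i
  rw [h0, h1] at h
  rw [fibMatrix_pow_mulVec_apply, fibMatrix_pow_symm _ i 0, fibMatrix_pow_symm _ i 1]
  exact h

/-- Each passage to a higher level extracts a factor of modulus at most φ⁻¹, while the base measures
stay in [0, 1]. Hence the e_s-component at level n is 0, and the measure vector is a multiple of (φ,
1). -/
theorem coordS_baseMeasure (n : ℕ) : coordS (D.baseMeasure μ n) = 0 := by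
  have key : ∀ m, |coordS (D.baseMeasure μ n)| ≤ φ⁻¹ ^ m * |coordS (D.baseMeasure μ (n + m))| := by
    intro m
    induction m with
    | zero => simp
    | succ m ih =>
      refine ih.trans ?_
      rw [D.baseMeasure_eq_pow_mulVec hpar hT hμ (n + m), coordS_pow_mulVec, abs_mul, abs_pow,
        abs_neg, abs_of_pos inv_goldenRatio_pos, pow_succ, mul_assoc]
      have h1 : φ⁻¹ ^ D.k (n + m + 2) ≤ φ⁻¹ ^ 1 :=
        pow_le_pow_of_le_one inv_goldenRatio_pos.le inv_goldenRatio_lt_one.le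
          (by have := D.k_gt (n + m + 2) (by omega); omega)
      rw [pow_one] at h1
      have h2 := inv_goldenRatio_pos
      rw [show n + (m + 1) = n + m + 1 by ring]
      gcongr
  have hb : ∀ m, |coordS (D.baseMeasure μ (n + m))| ≤ 3 := by
    intro m
    have h0 := D.baseMeasure_nonneg (μ := μ) (n + m) 0
    have h1 := D.baseMeasure_nonneg (μ := μ) (n + m) 1
    have h0' := D.baseMeasure_le_one (μ := μ) (n + m) 0
    have h1' := D.baseMeasure_le_one (μ := μ) (n + m) 1
    have h2 := Real.goldenRatio_lt_two
    have h3 := Real.goldenRatio_pos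
    rw [coordS, abs_mul, abs_of_pos normFactor_pos]
    have h4 : |-D.baseMeasure μ (n + m) 0 + φ * D.baseMeasure μ (n + m) 1| ≤ 3 := by
      rw [abs_le]
      constructor <;> nlinarith
    calc _ ≤ 1 * 3 := mul_le_mul normFactor_lt_one.le h4 (abs_nonneg _) zero_le_one
      _ = 3 := one_mul _
  have hlim : Tendsto (fun m : ℕ => φ⁻¹ ^ m * 3) atTop (𝓝 0) := by
    simpa using (tendsto_pow_atTop_nhds_zero_of_lt_one inv_goldenRatio_pos.le
      inv_goldenRatio_lt_one).mul_const 3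
  refine abs_nonpos_iff.1 (ge_of_tendsto' hlim fun m => (key m).trans ?_)
  exact mul_le_mul_of_nonneg_left (hb m) (pow_nonneg inv_goldenRatio_pos.le m)

theorem baseMeasure_zero (n : ℕ) : D.baseMeasure μ n 0 = φ * D.baseMeasure μ n 1 := by
  have h := D.coordS_baseMeasure hpar hT hμ n
  rw [coordS] at h
  have := (mul_eq_zero.1 h).resolve_left normFactor_pos.ne'
  linarith

theorem baseMeasure_succ (n : ℕ) (i : Fin 2) :
    D.baseMeasure μ (n + 1) i = φ⁻¹ ^ D.k (n + 2) * D.baseMeasure μ n i := by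
  have h1 := congrArg coordU (D.baseMeasure_eq_pow_mulVec hpar hT hμ n)
  rw [coordU_pow_mulVec, coordU, coordU, D.baseMeasure_zero hpar hT hμ n,
    D.baseMeasure_zero hpar hT hμ (n + 1)] at h1
  have h2 : normFactor * (φ ^ 2 + 1) ≠ 0 :=
    (mul_pos normFactor_pos (by have := Real.goldenRatio_pos; positivity)).ne'
  have h3 : D.baseMeasure μ n 1 = φ ^ D.k (n + 2) * D.baseMeasure μ (n + 1) 1 := by
    refine mul_left_cancel₀ h2 ?_
    linear_combination h1
  have h4 : D.baseMeasure μ (n + 1) 1 = φ⁻¹ ^ D.k (n + 2) * D.baseMeasure μ n 1 := by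
    rw [h3, ← mul_assoc, ← mul_pow, inv_mul_cancel₀ Real.goldenRatio_ne_zero, one_pow, one_mul]
  match i with
  | 0 =>
    rw [D.baseMeasure_zero hpar hT hμ n, D.baseMeasure_zero hpar hT hμ (n + 1), h4]
    ring
  | 1 => exact h4

theorem baseMeasure_succ_le (n : ℕ) (i : Fin 2) : D.baseMeasure μ (n + 1) i ≤ ε (n + 2) := by
  rw [D.baseMeasure_succ hpar hT hμ]
  have h1 := D.k_eps (n + 2) (by omega)
  have h2 := D.baseMeasure_le_one (μ := μ) n i
  have h3 := pow_pos inv_goldenRatio_pos (D.k (n + 2))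
  exact (mul_le_of_le_one_right h3.le h2).trans h1

omit [IsProbabilityMeasure μ] hT hμ hpar in
theorem height_pos_vtx (hpar : IsParameter ε δ v₁) (n : ℕ) (i : Fin 2) :
    0 < (D.diagram.height (n + 1) (D.vtx n i) : ℝ) :=
  Nat.cast_pos.2 (height_pos (D.isBratteli hpar) _ _)

omit [IsProbabilityMeasure μ] hT hμ hpar in
-- The direction of the vector of base measures is forced at each level, and the total mass 1,
-- expressed through the heights, fixes its length.
theorem isUniquelyErgodic (hpar : IsParameter ε δ v₁) [Nonempty D.diagram.Path]
    {T : D.diagram.Path ≃ₜ D.diagram.Path} (hT : D.diagram.IsVershik T) :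
    IsUniquelyErgodic T := by
  obtain ⟨μ, hμ, hTμ⟩ := exists_invariant_measure_path (D.isBratteli hpar) T.continuous
  refine ⟨μ, ⟨hμ, hTμ⟩, ?_⟩
  rintro ν ⟨hν, hTν⟩
  have h1 : ∀ n, D.baseMeasure ν n 1 = D.baseMeasure μ n 1 := by
    intro n
    have h2 := D.height_mul_baseMeasure hT hTν n
    have h3 := D.height_mul_baseMeasure hT hTμ n
    rw [D.baseMeasure_zero hpar hT hTν] at h2
    rw [D.baseMeasure_zero hpar hT hTμ] at h3
    have h4 : 0 < (D.diagram.height (n + 1) (D.vtx n 0) : ℝ) * φ +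
        D.diagram.height (n + 1) (D.vtx n 1) := by
      have := D.height_pos_vtx hpar n 0
      have := D.height_pos_vtx hpar n 1
      have := Real.goldenRatio_pos
      positivity
    refine mul_left_cancel₀ h4.ne' ?_
    linear_combination h2 - h3
  refine hT.measure_eq (D.isBratteli hpar) hTν hTμ fun n j => ?_
  change D.baseMeasure ν n j = D.baseMeasure μ n j
  rcases Fin.exists_fin_two.1 ⟨(j : Fin 2), rfl⟩ with h | h
  · rw [h, D.baseMeasure_zero hpar hT hTν, D.baseMeasure_zero hpar hT hTμ, h1]
  · rw [h, h1]

end Construction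

end FibExample

namespace FibExample

local notation "φ" => Real.goldenRatio

/-- The number `exp (2 i π a)`. -/
noncomputable def unitExp (a : ℝ) : ℂ := Complex.exp (2 * Real.pi * Complex.I * a)

theorem norm_unitExp (a : ℝ) : ‖unitExp a‖ = 1 := by
  rw [unitExp, show 2 * (Real.pi : ℂ) * Complex.I * a = ((2 * Real.pi * a : ℝ) : ℂ) * Complex.I by
    push_cast; ring]
  exact Complex.norm_exp_ofReal_mul_I _

theorem unitExp_pow (a : ℝ) (r : ℕ) : unitExp a ^ r = unitExp (a * r) := by
  rw [unitExp, unitExp, ← Complex.exp_nat_mul]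
  congr 1
  push_cast
  ring

theorem unitExp_add_int (a : ℝ) (z : ℤ) : unitExp (a + z) = unitExp a := by
  rw [unitExp, unitExp, Complex.exp_eq_exp_iff_exists_int]
  exact ⟨z, by push_cast; ring⟩

theorem norm_unitExp_sub_one_le (a : ℝ) : ‖unitExp a - 1‖ ≤ 2 * Real.pi * |a| := by
  have h := Real.norm_exp_I_mul_ofReal_sub_one_le (x := 2 * Real.pi * a)
  rw [Real.norm_eq_abs, abs_mul, abs_of_pos Real.two_pi_pos] at h
  rw [unitExp, show 2 * (Real.pi : ℂ) * Complex.I * a = Complex.I * ((2 * Real.pi * a : ℝ) : ℂ) by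
    push_cast; ring]
  exact h

namespace Construction

open OrderedDiagram

variable {ε δ : ℕ → ℝ} {v₁ : ℝ} (hpar : IsParameter ε δ v₁) (D : Construction ε δ v₁)

/-! ### A measurable eigenfunction -/

/-- The approximate eigenfunctions: powers of the eigenvalue, constant on the floors. -/
noncomputable def approxEigen (n : ℕ) (x : D.diagram.Path) : ℂ := unitExp D.α ^ rank x n

theorem continuous_approxEigen (n : ℕ) : Continuous (D.approxEigen n) :=
  (continuous_of_discreteTopology (f := fun r : ℕ => unitExp D.α ^ r)).comp (continuous_rank n)

theorem norm_approxEigen (n : ℕ) (x : D.diagram.Path) : ‖D.approxEigen n x‖ = 1 := by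
  rw [approxEigen, norm_pow, norm_unitExp, one_pow]

/-- The points at which the partial sums of the best ordering are not close to `h`. -/
def badSet (n : ℕ) : Set D.diagram.Path :=
  {x | D.w (n + 1) 1 < |bestDefect (D.w (n + 1))
    ((fibMatrix ℕ ^ D.k (n + 2)) (x.1 (n + 1)).target) (x.1 (n + 1)).pos|}

theorem mem_badSet_iff {n : ℕ} {x : D.diagram.Path} : x ∈ D.badSet n ↔ D.w (n + 1) 1 <
    |bestDefect (D.w (n + 1)) ((fibMatrix ℕ ^ D.k (n + 2)) (x.1 (n + 1)).target)
      (x.1 (n + 1)).pos| := Iff.rfl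

include hpar in
-- The rank grows by a partial height, so the two values differ by the factor exp(2iπ(defect + entry
-- of w)). Off the bad set both terms are small. The shift to `badSet (n + 1)` ensures that only
-- entries of w with index at least 2 are estimated.
theorem dist_approxEigen_le {n : ℕ} {x : D.diagram.Path} (hx : x ∉ D.badSet (n + 1)) :
    dist (D.approxEigen (n + 2) x) (D.approxEigen (n + 3) x) ≤
      2 * Real.pi * (D.bound * ε (n + 2) + D.bound * ε (n + 3)) := by
  obtain ⟨z, hz⟩ := D.exists_alpha_mul_partialHeight' hpar (n + 1) (x.1 (n + 2)).target
    (m := (x.1 (n + 2)).pos) (x.1 (n + 2)).pos_lt.le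
  have h1 : unitExp D.α ^ (D.diagram.partialHeight (n + 2) (x.1 (n + 2)).target
      (x.1 (n + 2)).pos) = _ := (unitExp_pow _ _).trans ((congrArg unitExp hz).trans
        (unitExp_add_int _ _))
  rw [dist_eq_norm', approxEigen, approxEigen, rank_succ, pow_add, ← mul_sub_one, norm_mul,
    norm_pow, norm_unitExp, one_pow, one_mul, h1]
  refine (norm_unitExp_sub_one_le _).trans ?_
  have h2 := not_lt.1 ((not_congr D.mem_badSet_iff).1 hx)
  have h3 := (le_abs_self _).trans (D.abs_w_le hpar n 1)
  have h4 := D.abs_w_le hpar (n + 1) (x.1 (n + 2)).target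
  refine mul_le_mul_of_nonneg_left ((abs_add_le _ _).trans (add_le_add (h2.trans h3) h4)) ?_
  positivity

include hpar in
theorem summable_bound :
    Summable fun n => 2 * Real.pi * (D.bound * ε (n + 2) + D.bound * ε (n + 3)) :=
  ((((summable_nat_add_iff 2).2 hpar.summable).mul_left _).add
    (((summable_nat_add_iff 3).2 hpar.summable).mul_left _)).mul_left _

include hpar in
theorem exists_tendsto_approxEigen {x : D.diagram.Path} (hx : ∀ᶠ n in atTop, x ∉ D.badSet n) :
    ∃ l, Tendsto (fun n => D.approxEigen n x) atTop (𝓝 l) := by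
  obtain ⟨N, hN⟩ := eventually_atTop.1 hx
  have h : CauchySeq fun n => D.approxEigen (n + N + 2) x := by
    refine cauchySeq_of_dist_le_of_summable
      (fun n => 2 * Real.pi * (D.bound * ε (n + N + 2) + D.bound * ε (n + N + 3))) (fun n => ?_)
      ((summable_nat_add_iff N).2 (D.summable_bound hpar))
    rw [show n.succ + N + 2 = n + N + 3 by omega]
    exact D.dist_approxEigen_le hpar (hN _ (by omega))
  obtain ⟨l, hl⟩ := cauchySeq_tendsto_of_complete h
  exact ⟨l, (tendsto_add_atTop_iff_nat (N + 2)).1 hl⟩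

variable {T : D.diagram.Path → D.diagram.Path} (hT : D.diagram.IsVershik T)
  {μ : Measure D.diagram.Path} [IsProbabilityMeasure μ] (hμ : MeasurePreserving T μ μ)

include hT in
theorem approxEigen_apply {x : D.diagram.Path} (hx : ¬ ∀ i, (x.1 i).IsMax) :
    ∀ᶠ n in atTop, D.approxEigen n (T x) = unitExp D.α * D.approxEigen n x := by
  obtain ⟨k, hk, hk'⟩ := exists_first_not hx
  filter_upwards [eventually_gt_atTop k] with n hn
  rw [approxEigen, hT.rank_apply fun h => hk' (h k hn), pow_succ', approxEigen]

include hT hμ hpar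

/-- The maximal path, where the rank need not increase by 1 under T, lies in floors of measure at
most ε_{n+2} for every n. -/
theorem ae_not_isMax : ∀ᵐ x ∂μ, ¬ ∀ i, (x.1 i).IsMax := by
  obtain ⟨vmin, vmax, h⟩ := hasExtremalSources_bestDiagram (D.bestPair hpar)
  obtain ⟨y, hy, huniq⟩ := (h.isProper (D.isBratteli hpar)).1
  have h1 : μ.real {y} = 0 := by
    refine le_antisymm ?_ measureReal_nonneg
    refine ge_of_tendsto' ((tendsto_add_atTop_iff_nat 2).2 hpar.summable.tendsto_atTop_zero)
      fun n => ?_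
    refine le_trans ?_ (D.baseMeasure_succ_le hpar hT hμ n (y.1 (n + 2)).source)
    refine (measureReal_mono ?_).trans_eq (hT.measureReal_floor hμ (rank_lt_height y (n + 2)))
    rintro x rfl
    exact ⟨rfl, rfl⟩
  rw [measureReal_eq_zero_iff] at h1
  refine measure_mono_null (fun x hx => ?_) h1
  exact huniq x (not_not.1 hx)

omit hpar in
-- Target and position determine the edge. The condition on the source fixes its height factor; the
-- set may also be empty.
theorem measureReal_letter_le (n : ℕ) (j : Fin 2) (m : ℕ) :
    μ.real {x | (x.1 (n + 1)).target = D.vtx (n + 1) j ∧ (x.1 (n + 1)).pos = m ∧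
      (x.1 (n + 1)).source = D.vtx n 1} ≤
      (D.diagram.height (n + 1) (D.vtx n 1) : ℝ) * D.baseMeasure μ (n + 1) j := by
  set S : Set D.diagram.Path := {x | (x.1 (n + 1)).target = D.vtx (n + 1) j ∧
    (x.1 (n + 1)).pos = m ∧ (x.1 (n + 1)).source = D.vtx n 1} with hS
  rcases S.eq_empty_or_nonempty with he | ⟨y, hy1, hy2, hy3⟩
  · rw [he, measureReal_empty]
    exact mul_nonneg (Nat.cast_nonneg _) (D.baseMeasure_nonneg _ _)
  · have h1 := hT.measureReal_edge hμ (y.1 (n + 1))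
    rw [hy1, hy3] at h1
    refine (measureReal_mono ?_).trans_eq h1
    rintro x ⟨hx1, hx2, -⟩
    exact Edge.eq_of_target_pos (hx1.trans hy1.symm) (hx2.trans hy2.symm)

/-- By symmetry of A the left side is the scalar product of w with the base measures one level
below. These are proportional to (φ, 1), hence to e_u, so only the e_u-component of w survives. -/
theorem sum_rowDot_mul_baseMeasure (n : ℕ) :
    D.rowDot n 0 * D.baseMeasure μ (n + 1) 0 + D.rowDot n 1 * D.baseMeasure μ (n + 1) 1 =
      normFactor⁻¹ * D.u (n + 1) * D.baseMeasure μ n 1 := by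
  have h0 := congrFun (D.baseMeasure_eq_pow_mulVec hpar hT hμ n) 0
  have h1 := congrFun (D.baseMeasure_eq_pow_mulVec hpar hT hμ n) 1
  rw [fibMatrix_pow_mulVec_apply] at h0 h1
  have h2 := D.baseMeasure_zero hpar hT hμ n
  have h3 := D.coordU_w (n + 1)
  rw [coordU] at h3
  have h4 : normFactor⁻¹ * D.u (n + 1) = φ * D.w (n + 1) 0 + D.w (n + 1) 1 := by
    rw [← h3, inv_mul_cancel_left₀ normFactor_pos.ne']
  rw [fibMatrix_pow_symm _ 0 1] at h0
  rw [h4, rowDot, rowDot, fibMatrix_pow_symm _ 0 1]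
  rw [fibMatrix_pow_symm _ 1 0] at *
  linear_combination (-D.w (n + 1) 0) * h0 - D.w (n + 1) 1 * h1 + D.w (n + 1) 0 * h2

/-- The bad positions lie in the initial block, at most ⌈⟨h, w⟩ / w(1)⌉ of them for each row h. The
quotients average to a multiple of u / w(1), of order δ; rounding up adds one letter per row, which
costs the ε-term. -/
theorem measureReal_badSet_le (n : ℕ) :
    μ.real (D.badSet n) ≤ (normFactor ^ 2 * φ)⁻¹ * δ (n + 1) + 3 * ε (n + 2) := by
  have hw := D.bestPair hpar n
  have hpos := (hw 0).pos
  set H := (D.diagram.height (n + 1) (D.vtx n 1) : ℝ) with hH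
  have hH0 : 0 < H := D.height_pos_vtx hpar n 1
  let N : Fin 2 → ℕ := fun j => ⌈D.rowDot n j / D.w (n + 1) 1⌉₊
  let S : Fin 2 → ℕ → Set D.diagram.Path := fun j m =>
    {x | (x.1 (n + 1)).target = D.vtx (n + 1) j ∧ (x.1 (n + 1)).pos = m ∧
      (x.1 (n + 1)).source = D.vtx n 1}
  have hsub : D.badSet n ⊆ ⋃ j ∈ Finset.univ, ⋃ m ∈ Finset.range (N j), S j m := by
    intro x hx
    have h1 := (hw (x.1 (n + 1)).target).lt_of_lt_abs_bestDefect hx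
    -- A positive defect never exceeds w(1), so at a bad position it is nonpositive and the letter
    -- is `1`.
    have h2 : bestLetter (D.w (n + 1)) ((fibMatrix ℕ ^ D.k (n + 2)) (x.1 (n + 1)).target)
        (x.1 (n + 1)).pos = 1 := by
      rw [bestLetter_eq_one_iff]
      by_contra h2
      refine (D.mem_badSet_iff.1 hx).not_ge ?_
      rw [abs_of_pos (not_le.1 h2)]
      exact (hw (x.1 (n + 1)).target).bestDefect_le _
    simp only [Set.mem_iUnion, Finset.mem_univ, Finset.mem_range]
    refine ⟨(x.1 (n + 1)).target, trivial, (x.1 (n + 1)).pos, ?_, rfl, rfl, h2⟩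
    exact Nat.lt_ceil.2 ((lt_div_iff₀ hpos).2 h1)
  have hbase := D.baseMeasure_nonneg (μ := μ) (n + 1)
  have hsum : ∀ j, μ.real (⋃ m ∈ Finset.range (N j), S j m) ≤
      (D.rowDot n j / D.w (n + 1) 1 + 1) * (H * D.baseMeasure μ (n + 1) j) := by
    intro j
    have hdot : 0 ≤ D.rowDot n j / D.w (n + 1) 1 := div_nonneg (hw j).dot_pos.le hpos.le
    calc _ ≤ ∑ m ∈ Finset.range (N j), μ.real (S j m) := measureReal_biUnion_finset_le _ _
      _ ≤ ∑ m ∈ Finset.range (N j), H * D.baseMeasure μ (n + 1) j :=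
        Finset.sum_le_sum fun m _ => D.measureReal_letter_le hT hμ n j m
      _ = N j * (H * D.baseMeasure μ (n + 1) j) := by simp
      _ ≤ _ := mul_le_mul_of_nonneg_right (Nat.ceil_lt_add_one hdot).le
        (mul_nonneg hH0.le (hbase j))
  have h1 : μ.real (D.badSet n) ≤
      (D.rowDot n 0 / D.w (n + 1) 1 + 1) * (H * D.baseMeasure μ (n + 1) 0) +
        (D.rowDot n 1 / D.w (n + 1) 1 + 1) * (H * D.baseMeasure μ (n + 1) 1) := by
    refine (measureReal_mono hsub (measure_ne_top _ _)).trans ((measureReal_biUnion_finset_le _ _).trans ?_)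
    rw [Fin.sum_univ_two]
    exact add_le_add (hsum 0) (hsum 1)
  have h2 := D.sum_rowDot_mul_baseMeasure hpar hT hμ n
  have h3 : H * D.baseMeasure μ n 1 ≤ 1 := D.height_mul_baseMeasure_le_one hT hμ n 1
  have h3' : 0 ≤ H * D.baseMeasure μ n 1 := mul_nonneg hH0.le (D.baseMeasure_nonneg n 1)
  have h4 : (D.rowDot n 0 / D.w (n + 1) 1 + 1) * (H * D.baseMeasure μ (n + 1) 0) +
        (D.rowDot n 1 / D.w (n + 1) 1 + 1) * (H * D.baseMeasure μ (n + 1) 1) =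
      (normFactor⁻¹ * D.u (n + 1) / D.w (n + 1) 1) * (H * D.baseMeasure μ n 1) +
        φ⁻¹ ^ D.k (n + 2) * (1 + φ) * (H * D.baseMeasure μ n 1) := by
    have h5 : D.baseMeasure μ (n + 1) 0 + D.baseMeasure μ (n + 1) 1 =
        φ⁻¹ ^ D.k (n + 2) * (1 + φ) * D.baseMeasure μ n 1 := by
      rw [D.baseMeasure_succ hpar hT hμ, D.baseMeasure_succ hpar hT hμ,
        D.baseMeasure_zero hpar hT hμ]
      ring
    linear_combination (H / D.w (n + 1) 1) * h2 + H * h5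
  have hu : normFactor⁻¹ * D.u (n + 1) / D.w (n + 1) 1 ≤ (normFactor ^ 2 * φ)⁻¹ * δ (n + 1) := by
    have hv := (D.v_mem (n + 1) (by omega)).1
    have hvw := D.v_lt_vw (n + 1)
    have hu := D.u_mem (n + 1) (by omega)
    have hφ := Real.goldenRatio_pos
    have hc := normFactor_pos
    -- Since w(1) ≥ cφv and u ≤ δv, the quotient c⁻¹u / w(1) is at most δ / (c²φ).
    have hw1 : normFactor * (φ * D.v (n + 1)) ≤ D.w (n + 1) 1 := by
      rw [w_one]
      refine mul_le_mul_of_nonneg_left ?_ hc.le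
      nlinarith [hu.1]
    rw [div_le_iff₀ hpos, inv_mul_le_iff₀ hc]
    have hδ := (hpar.delta_mem (n + 1) (by omega)).1
    calc D.u (n + 1) ≤ δ (n + 1) * D.v (n + 1) := hu.2
      _ = normFactor * ((normFactor ^ 2 * φ)⁻¹ * δ (n + 1) *
          (normFactor * (φ * D.v (n + 1)))) := by
        field_simp
      _ ≤ _ := by gcongr
  have hk : φ⁻¹ ^ D.k (n + 2) * (1 + φ) ≤ 3 * ε (n + 2) := by
    have := D.k_eps (n + 2) (by omega)
    have h6 := pow_pos inv_goldenRatio_pos (D.k (n + 2))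
    nlinarith [Real.goldenRatio_lt_two, Real.goldenRatio_pos]
  have hnonneg1 : 0 ≤ normFactor⁻¹ * D.u (n + 1) / D.w (n + 1) 1 :=
    div_nonneg (mul_nonneg (inv_nonneg.2 normFactor_pos.le) (D.u_pos (by omega)).le) hpos.le
  have hnonneg2 : 0 ≤ φ⁻¹ ^ D.k (n + 2) * (1 + φ) :=
    mul_nonneg (pow_pos inv_goldenRatio_pos _).le (by linarith [Real.goldenRatio_pos])
  rw [h4] at h1
  exact h1.trans (add_le_add ((mul_le_of_le_one_right hnonneg1 h3).trans hu)
    ((mul_le_of_le_one_right hnonneg2 h3).trans hk))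

theorem ae_eventually_notMem_badSet : ∀ᵐ x ∂μ, ∀ᶠ n in atTop, x ∉ D.badSet n := by
  have hs : Summable fun n => μ.real (D.badSet n) := by
    have hδ : Summable fun n => δ (n + 1) :=
      Summable.of_nonneg_of_le (fun n => (hpar.delta_mem (n + 1) (by omega)).1.le)
        (fun n => hpar.delta_le (n + 1) (by omega)) ((summable_nat_add_iff 1).2 hpar.summable)
    exact Summable.of_nonneg_of_le (fun n => measureReal_nonneg)
      (D.measureReal_badSet_le hpar hT hμ)
      ((hδ.mul_left _).add (((summable_nat_add_iff 2).2 hpar.summable).mul_left _))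
  refine ae_eventually_notMem ?_
  have : ∀ n, μ (D.badSet n) = ENNReal.ofReal (μ.real (D.badSet n)) := fun n =>
    (ofReal_measureReal).symm
  simp only [this]
  exact hs.tsum_ofReal_ne_top

omit hT hμ in
-- The approximations have modulus 1, so their almost sure limit is bounded and nonzero. They
-- satisfy the eigenvalue equation exactly once n exceeds the first non-maximal index.
theorem isMeasurableEigenvalue {T : D.diagram.Path ≃ₜ D.diagram.Path}
    (hT : D.diagram.IsVershik T) (hμ : MeasurePreserving T μ μ) :
    IsMeasurableEigenvalue T μ (unitExp D.α) := by
  obtain ⟨f, hf, hlim⟩ := measurable_limit_of_tendsto_metrizable_ae (μ := μ) (L := atTop)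
    (fun n => (D.continuous_approxEigen n).measurable.aemeasurable)
    ((D.ae_eventually_notMem_badSet hpar hT hμ).mono fun x =>
      D.exists_tendsto_approxEigen hpar)
  have hnorm : ∀ᵐ x ∂μ, ‖f x‖ = 1 := hlim.mono fun x hx =>
    tendsto_nhds_unique hx.norm (by simp [norm_approxEigen])
  refine ⟨f, MemLp.of_bound hf.aestronglyMeasurable 1 (hnorm.mono fun x hx => hx.le), ?_, ?_⟩
  · intro h0
    obtain ⟨x, hx, hx'⟩ := (h0.and hnorm).exists
    rw [hx] at hx'
    simp at hx'
  · filter_upwards [hlim, hμ.quasiMeasurePreserving.ae hlim, D.ae_not_isMax hpar hT hμ]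
      with x h1 h2 h3
    refine tendsto_nhds_unique h2 ((h1.const_mul _).congr' ?_)
    exact (D.approxEigen_apply hT h3).mono fun n hn => hn.symm

end Construction

end FibExample

/-! ### Absence of continuous eigenfunctions -/

namespace FibExample

local notation "φ" => Real.goldenRatio

theorem re_unitExp (a : ℝ) : (unitExp a).re = Real.cos (2 * Real.pi * a) := by
  rw [unitExp, show 2 * (Real.pi : ℂ) * Complex.I * a = ((2 * Real.pi * a : ℝ) : ℂ) * Complex.I by
    push_cast; ring]
  exact Complex.exp_ofReal_mul_I_re _

theorem one_le_norm_unitExp_sub_one {a : ℝ} (h : 1 / 4 ≤ a) (h' : a ≤ 1 / 2) :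
    1 ≤ ‖unitExp a - 1‖ := by
  have h1 : (unitExp a).re ≤ 0 := by
    rw [re_unitExp]
    refine Real.cos_nonpos_of_pi_div_two_le_of_le ?_ ?_ <;> nlinarith [Real.pi_pos]
  refine le_trans ?_ (Complex.abs_re_le_norm _)
  rw [Complex.sub_re, Complex.one_re, abs_of_nonpos (by linarith)]
  linarith

theorem apply_zpow_eq_zero {X : Type*} [TopologicalSpace X] {T : X ≃ₜ X} {f : X → ℂ} {lam : ℂ}
    (hlam : lam ≠ 0) (hf : ∀ x, f (T x) = lam * f x) {x : X} (hx : f x = 0) (m : ℤ) :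
    f ((T ^ m) x) = 0 := by
  induction m with
  | zero => exact hx
  | succ m ih =>
    rw [add_comm, zpow_one_add]
    change f (T ((T ^ (m : ℤ)) x)) = 0
    rw [hf, ih, mul_zero]
  | pred m ih =>
    have h1 : T ((T ^ (-(m : ℤ) - 1)) x) = (T ^ (-(m : ℤ))) x := by
      have : T ^ (-(m : ℤ)) = T * T ^ (-(m : ℤ) - 1) := by
        rw [← zpow_one_add]
        congr 1
        ring
      rw [this]
      rfl
    rw [← h1, hf] at ih
    exact (mul_eq_zero.1 ih).resolve_left hlam

/-- A continuous eigenfunction of a minimal system does not vanish. -/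
theorem eigenfunction_ne_zero {X : Type*} [TopologicalSpace X] {T : X ≃ₜ X}
    (hT : IsMinimalHomeo T) {f : X → ℂ} (hc : Continuous f) {lam : ℂ} (hlam : lam ≠ 0)
    (hf : ∀ x, f (T x) = lam * f x) (hne : f ≠ 0) (x : X) : f x ≠ 0 := by
  intro hx
  refine hne (hc.ext_on (hT x) continuous_const ?_)
  rintro _ ⟨m, rfl⟩
  exact apply_zpow_eq_zero hlam hf hx m

theorem apply_iterate_eq {X : Type*} {T : X → X} {f : X → ℂ} {lam : ℂ}
    (hf : ∀ x, f (T x) = lam * f x) (m : ℕ) (x : X) : f (T^[m] x) = lam ^ m * f x := by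
  induction m with
  | zero => simp
  | succ m ih => rw [Function.iterate_succ_apply', hf, ih, pow_succ', mul_assoc]

/-- A sequence of multiples that avoids `[1/4, 1/2]` modulo `1` and moves in small steps stays
below `1/4`. -/
theorem lt_half_of_norm_unitExp_sub_one_lt {a X : ℝ} (ha : 0 < a) (ha' : a < 1 / 4) (hX : 0 < X)
    (h : ∀ m : ℕ, m * a ≤ X → ‖unitExp (m * a) - 1‖ < 1) : X < 1 / 2 := by
  have key : ∀ m : ℕ, m * a ≤ X → m * a < 1 / 4 := by
    intro m
    induction m with
    | zero => simp
    | succ m ih =>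
      intro hm
      have h1 := ih (by push_cast at hm; linarith)
      by_contra h2
      refine (h _ hm).not_ge (one_le_norm_unitExp_sub_one (not_lt.1 h2) ?_)
      push_cast
      linarith
  -- With m = ⌊X / a⌋, the last multiple below X, X < ma + a < 1/4 + 1/4.
  have h1 := Nat.floor_le (div_nonneg hX.le ha.le)
  have h2 := Nat.lt_floor_add_one (X / a)
  rw [le_div_iff₀ ha] at h1
  rw [div_lt_iff₀ ha] at h2
  have := key _ h1
  linarith

namespace Construction

open OrderedDiagram

variable {ε δ : ℕ → ℝ} {v₁ : ℝ} (hpar : IsParameter ε δ v₁) (D : Construction ε δ v₁)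

include hpar

theorem exists_hasExtremalSources : ∃ vmin vmax, D.diagram.HasExtremalSources vmin vmax :=
  hasExtremalSources_bestDiagram (D.bestPair hpar)

theorem isProper : D.diagram.IsProper := by
  obtain ⟨vmin, vmax, h⟩ := D.exists_hasExtremalSources hpar
  exact h.isProper (D.isBratteli hpar)

theorem nonempty_path : Nonempty D.diagram.Path := ⟨(D.isProper hpar).1.choose⟩

theorem connected : ∀ n ≥ 1, ∀ (i : D.diagram.V n) (j : D.diagram.V (n + 1)),
    ∃ o, D.diagram.src n j o = i := connected_bestDiagram (D.bestPair hpar)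

omit hpar in
/-- If `⟨h, w (n + 1)⟩` is eventually small, then the components `u n` do not converge to `0`. -/
theorem not_eventually_rowDot_lt (hpar : IsParameter ε δ v₁) :
    ¬ ∀ᶠ n in atTop, ∀ j, D.rowDot n j < 1 / 2 := by
  intro h
  have hsmall : ∀ᶠ n in atTop, ∀ j, |D.w (n + 2) j| < 1 / 2 := by
    have h1 : ∀ j, ∀ᶠ n in atTop, |D.w (n + 2) j| < 1 / 2 := by
      intro j
      have := ((tendsto_add_atTop_iff_nat 2).2 (D.tendsto_w hpar j)).abs
      rw [abs_zero] at this
      exact this.eventually_lt_const (by norm_num)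
    filter_upwards [h1 0, h1 1] with n h0 h1 j
    match j with
    | 0 => exact h0
    | 1 => exact h1
  obtain ⟨N, hN⟩ := eventually_atTop.1 (h.and hsmall)
  have hstep : ∀ n ≥ N, D.u (n + 1) ≤ D.u (n + 2) := by
    intro n hn
    obtain ⟨h1, h2⟩ := hN n hn
    obtain ⟨z, hz⟩ := D.exists_rowDot_eq n
    -- ⟨h, w⟩ lies in (0, 1/2) and the next entry of w in (-1/2, 1/2); their difference is an
    -- integer of modulus less than 1.
    have hz0 : ∀ j, z j = 0 := by
      intro j
      have h3 := (D.bestPair hpar n j).dot_pos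
      change 0 < D.rowDot n j at h3
      have h4 := hz j
      have h5 := h1 j
      have h6 := abs_lt.1 (h2 j)
      refine Int.abs_lt_one_iff.1 ?_
      have : |(z j : ℝ)| < 1 := abs_lt.2 ⟨by linarith, by linarith⟩
      exact_mod_cast this
    have h3 : (fibMatrix ℝ ^ D.k (n + 2)) *ᵥ D.w (n + 1) = D.w (n + 2) := by
      ext j
      have h4 := hz j
      rw [hz0, Int.cast_zero, add_zero] at h4
      rw [fibMatrix_pow_mulVec_apply]
      exact h4
    have h4 := congrArg coordU h3
    rw [coordU_pow_mulVec, coordU_w, coordU_w] at h4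
    rw [← h4]
    exact le_mul_of_one_le_left (D.u_pos (by omega)).le (one_le_pow₀ Real.one_lt_goldenRatio.le)
  have hmono : ∀ n, D.u (N + 1) ≤ D.u (n + (N + 1)) := by
    intro n
    induction n with
    | zero => simp
    | succ n ih =>
      refine ih.trans ?_
      have := hstep (n + N) (by omega)
      rwa [show n + 1 + (N + 1) = n + N + 2 by omega, show n + (N + 1) = n + N + 1 by omega]
  have := ge_of_tendsto' ((tendsto_add_atTop_iff_nat (N + 1)).2 (D.tendsto_u hpar)) hmono
  exact this.not_gt (D.u_pos (by omega))

/-- A path through the vertex `j` of level `n + 2` that is minimal up to there. -/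
theorem exists_path_isMin (n : ℕ) (j : Fin 2) : ∃ y : D.diagram.Path,
    (∀ i < n + 2, (y.1 i).IsMin) ∧ (y.1 (n + 2)).source = D.vtx (n + 1) j := by
  obtain ⟨x⟩ := D.nonempty_path hpar
  obtain ⟨o, ho⟩ := D.connected hpar (n + 2) (by omega) (D.vtx (n + 1) j) (x.1 (n + 2)).target
  obtain ⟨y, -, hy, hmin⟩ := exists_path_of_edge _ (exists_isMin (D.isBratteli hpar)) x
    (e := ⟨_, o⟩) rfl
  exact ⟨y, hmin, by rw [hy]; exact ho⟩

/-- Take y minimal up to level n + 2. Moving y up by the partial height of m letters of the initial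
block reaches the bottom of another slice, again minimal up to level n + 1. Both points are near the
minimal path, yet the eigenfunction changes by the factor exp(2iπ m w(1)). -/
theorem not_isContinuousEigenvalue {T : D.diagram.Path ≃ₜ D.diagram.Path}
    (hT : D.diagram.IsVershik T) (hmin : IsMinimalHomeo T) :
    ¬ IsContinuousEigenvalue T (unitExp D.α) := by
  rintro ⟨f, hc, hne, hf⟩
  have hB := D.isBratteli hpar
  obtain ⟨vmin, vmax, hext⟩ := D.exists_hasExtremalSources hpar
  obtain ⟨x, hx, -⟩ := (D.isProper hpar).2
  have hlam : unitExp D.α ≠ 0 := Complex.exp_ne_zero _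
  have hfx : 0 < ‖f x‖ := norm_pos_iff.2 (eigenfunction_ne_zero hmin hc hlam hf hne x)
  -- With radius ‖f x‖ / 4 the two values of f differ by less than ‖f x‖ / 2 while ‖f y‖ ≥ 3‖f x‖ /
  -- 4, so the phase factor is within 2/3 < 1 of 1.
  obtain ⟨N, hN⟩ := hext.eventually_of_mem_nhds hx
    (hc.continuousAt.preimage_mem_nhds (Metric.ball_mem_nhds (f x) (by positivity : 0 < ‖f x‖ / 4)))
  have hw1 : ∀ᶠ n in atTop, D.w (n + 1) 1 < 1 / 4 :=
    ((tendsto_add_atTop_iff_nat 1).2 (D.tendsto_w hpar 1)).eventually_lt_const (by norm_num)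
  refine D.not_eventually_rowDot_lt hpar ?_
  filter_upwards [hw1, eventually_ge_atTop N] with n hwn hn j
  have hw := D.bestPair hpar n j
  refine lt_half_of_norm_unitExp_sub_one_lt hw.pos hwn hw.dot_pos fun m hm => ?_
  obtain ⟨hs0, hs1⟩ := hw.bestSum_initial hm
  have hdeg : m < D.diagram.deg (n + 1) (D.vtx (n + 1) j) := by
    have h1 : D.diagram.deg (n + 1) (D.vtx (n + 1) j) = _ := deg_vertex n j
    have h2 : (0 : ℝ) < (fibMatrix ℕ ^ D.k (n + 2)) j 0 := Nat.cast_pos.2 (hw.height_pos 0)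
    have h3 : (m : ℝ) < (fibMatrix ℕ ^ D.k (n + 2)) j 1 := by
      refine lt_of_mul_lt_mul_right (a := D.w (n + 1) 1) ?_ hw.pos.le
      have h4 := mul_neg_of_pos_of_neg h2 hw.neg
      have h5 := hm
      rw [rowDot] at h5
      linarith
    have h4 : m < (fibMatrix ℕ ^ D.k (n + 2)) j 1 := by exact_mod_cast h3
    omega
  obtain ⟨z, hz⟩ := D.exists_alpha_mul_partialHeight hpar n j hdeg.le
  rw [hs0, hs1, Nat.cast_zero, zero_mul, zero_add] at hz
  obtain ⟨y, hymin, hysrc⟩ := D.exists_path_isMin hpar n j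
  let e : D.diagram.Edge (n + 1) := ⟨D.vtx (n + 1) j, m, hdeg⟩
  set r := D.diagram.partialHeight (n + 1) (D.vtx (n + 1) j) m with hr
  have hrank := rank_eq_zero_of_isMin hymin
  have hrlt : r < D.diagram.height (n + 2) (D.vtx (n + 1) j) := by
    have h1 : r + D.diagram.height (n + 1) e.source ≤ _ := partialHeight_add_height_le e
    have h2 := height_pos hB (n + 1) e.source
    exact lt_of_lt_of_le (by omega) h1
  obtain ⟨h1, h2⟩ := hT.rank_iterate (x := y) (n := n + 2) r (by
    rw [hrank, hysrc]
    omega)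
  have h3 : T^[r] y ∈ floor (n + 2) e.target (D.diagram.partialHeight (n + 1) e.target e.pos + 0) :=
    ⟨by rw [h2 _ le_rfl]; exact hysrc, by rw [h1, hrank, zero_add]; rfl⟩
  rw [floor_succ_partialHeight e (height_pos hB _ _)] at h3
  have h4 := isMin_of_rank_eq_zero hB h3.2
  have h5 := hN y fun i hi => hymin i (by omega)
  have h6 := hN _ fun i hi => h4 i (by omega)
  rw [Set.mem_preimage, mem_ball_iff_norm] at h5 h6
  have h7 : ‖unitExp (m * D.w (n + 1) 1) - 1‖ * ‖f y‖ < ‖f x‖ / 2 := by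
    have h8 : unitExp D.α ^ r = unitExp (m * D.w (n + 1) 1) := by
      rw [unitExp_pow, ← unitExp_add_int (m * D.w (n + 1) 1) z]
      exact congrArg unitExp hz
    rw [← h8, ← norm_mul, sub_one_mul, ← apply_iterate_eq hf]
    calc _ = ‖(f (T^[r] y) - f x) - (f y - f x)‖ := by congr 1; ring
      _ ≤ _ := norm_sub_le _ _
      _ < ‖f x‖ / 2 := by linarith
  have h8 : 3 / 4 * ‖f x‖ ≤ ‖f y‖ := by
    have := norm_sub_norm_le (f x) (f y)
    rw [norm_sub_rev] at this
    linarith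
  by_contra h9
  have := mul_le_mul (not_lt.1 h9) h8 (by positivity) (norm_nonneg _)
  linarith

end Construction

end FibExample

namespace FibExample

local notation "φ" => Real.goldenRatio

/-! ### Existence of the construction -/

theorem exists_pow_inv_goldenRatio_lt {a : ℝ} (ha : 0 < a) :
    ∃ N : ℕ, ∀ n ≥ N, φ⁻¹ ^ n < a :=
  eventually_atTop.1 ((tendsto_pow_atTop_nhds_zero_of_lt_one inv_goldenRatio_pos.le
    inv_goldenRatio_lt_one).eventually_lt_const ha)

/-- One step of the construction: from the number `v = v n` and the bounds `e = ε (n + 1)` and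
`d = δ n` to the depth `m` of a lattice vector `A ^ m (1, 0)` and the exponent `k (n + 1)`. -/
theorem exists_step {e d v : ℝ} (he : 0 < e) (hd : 0 < d) (hv : 0 < v) :
    ∃ m k : ℕ, Even m ∧ Even k ∧ 2 < k ∧ φ⁻¹ ^ k ≤ e ∧
      φ⁻¹ ^ k * v + normFactor * φ⁻¹ ^ m < e ∧
      φ⁻¹ ^ k * (normFactor * φ ^ (m + 1) + 1) ≤ d * v := by
  -- The depth m is fixed first, so that the lattice vector adds less than e/2 to v; then k is taken
  -- large in terms of m, v and d. Even exponents avoid signs in the e_s-direction, and the summand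
  -- 1 leaves room for the next u.
  obtain ⟨M, hM⟩ := exists_pow_inv_goldenRatio_lt (half_pos he)
  have hc := normFactor_pos
  have hφ := Real.goldenRatio_pos
  set Z := normFactor * φ ^ (2 * M + 1) + 1 with hZ
  have hZ0 : 0 < Z := by positivity
  obtain ⟨N, hN⟩ := exists_pow_inv_goldenRatio_lt
    (a := min e (min (e / 2 / v) (d * v / Z))) (by positivity)
  refine ⟨2 * M, 2 * (N + 2), even_two_mul _, even_two_mul _, by omega, ?_, ?_, ?_⟩
  all_goals
    have h1 := hN (2 * (N + 2)) (by omega)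
    obtain ⟨h2, h3⟩ := lt_min_iff.1 h1
    obtain ⟨h3, h4⟩ := lt_min_iff.1 h3
  · exact h2.le
  · have h5 := hM (2 * M) (by omega)
    have h6 := (lt_div_iff₀ hv).1 h3
    have h7 : normFactor * φ⁻¹ ^ (2 * M) ≤ φ⁻¹ ^ (2 * M) :=
      mul_le_of_le_one_left (pow_pos inv_goldenRatio_pos _).le normFactor_lt_one.le
    linarith
  · exact ((lt_div_iff₀ hZ0).1 h4).le

/-- The data chosen in one step. -/
structure StepData (ε δ : ℕ → ℝ) (n : ℕ) (v : ℝ) where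
  m : ℕ
  k : ℕ
  even_m : Even m
  even_k : Even k
  k_gt : 2 < k
  k_eps : φ⁻¹ ^ k ≤ ε (n + 2)
  next_lt : φ⁻¹ ^ k * v + normFactor * φ⁻¹ ^ m < ε (n + 2)
  le_delta : φ⁻¹ ^ k * (normFactor * φ ^ (m + 1) + 1) ≤ δ (n + 1) * v

namespace StepData

variable {ε δ : ℕ → ℝ} {v₁ : ℝ}

theorem nonempty (hpar : IsParameter ε δ v₁) (n : ℕ) {v : ℝ} (hv : 0 < v) :
    Nonempty (StepData ε δ n v) := by
  obtain ⟨m, k, h1, h2, h3, h4, h5, h6⟩ := exists_step (hpar.eps_mem (n + 2) (by omega)).1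
    (hpar.delta_mem (n + 1) (by omega)).1 hv
  exact ⟨⟨m, k, h1, h2, h3, h4, h5, h6⟩⟩

variable {n : ℕ} {v : ℝ}

/-- The number that follows `v`. -/
noncomputable def next (s : StepData ε δ n v) : ℝ := φ⁻¹ ^ s.k * v + normFactor * φ⁻¹ ^ s.m

theorem next_pos (hv : 0 < v) (s : StepData ε δ n v) : 0 < s.next := by
  have := inv_goldenRatio_pos
  have := normFactor_pos
  unfold next
  positivity

end StepData

section Existence

variable {ε δ : ℕ → ℝ} {v₁ : ℝ} (hpar : IsParameter ε δ v₁)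

/-- The sequence `v (n + 1)`, with its positivity. -/
noncomputable def seqV : ℕ → {v : ℝ // 0 < v}
  | 0 => ⟨v₁, hpar.v_mem.1⟩
  | n + 1 => ⟨_, (StepData.nonempty hpar n (seqV n).2).some.next_pos (seqV n).2⟩

/-- The data of the step from `n + 1` to `n + 2`. -/
noncomputable def seqStep (n : ℕ) : StepData ε δ n (seqV hpar n) :=
  (StepData.nonempty hpar n (seqV hpar n).2).some

theorem seqV_succ (n : ℕ) : (seqV hpar (n + 1) : ℝ) = (seqStep hpar n).next := rfl

theorem seqV_lt (n : ℕ) : (seqV hpar n : ℝ) < ε (n + 1) := by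
  cases n with
  | zero => exact hpar.v_mem.2
  | succ n => exact (seqStep hpar n).next_lt

/-- The sum of the first `n` exponents. -/
noncomputable def seqK (n : ℕ) : ℕ := ∑ i ∈ Finset.range n, (seqStep hpar i).k

theorem seqK_succ (n : ℕ) : seqK hpar (n + 1) = seqK hpar n + (seqStep hpar n).k :=
  Finset.sum_range_succ _ _

/-- The partial sums of the series for `β`. -/
noncomputable def seqY (n : ℕ) : ℝ :=
  ∑ i ∈ Finset.range n, φ⁻¹ ^ seqK hpar (i + 1) * (normFactor * φ ^ ((seqStep hpar i).m + 1))

theorem seqY_succ (n : ℕ) : seqY hpar (n + 1) =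
    seqY hpar n + φ⁻¹ ^ seqK hpar (n + 1) * (normFactor * φ ^ ((seqStep hpar n).m + 1)) :=
  Finset.sum_range_succ _ _

theorem seqY_strictMono : StrictMono (seqY hpar) := by
  refine strictMono_nat_of_lt_succ fun n => ?_
  have := inv_goldenRatio_pos
  have := normFactor_pos
  have := Real.goldenRatio_pos
  rw [seqY_succ]
  exact lt_add_of_pos_right _ (by positivity)

/-- Upper bounds for the sum of the series for `β`. -/
noncomputable def seqTop (n : ℕ) : ℝ :=
  seqY hpar n + φ⁻¹ ^ seqK hpar n * (δ (n + 1) * seqV hpar n)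

theorem delta_mul_seqV_lt_one (n : ℕ) : δ (n + 1) * seqV hpar n < 1 := by
  have h1 := hpar.delta_mem (n + 1) (by omega)
  have h2 := hpar.eps_mem (n + 1) (by omega)
  have h3 := seqV_lt hpar n
  have h4 := (seqV hpar n).2
  have h5 := inv_goldenRatio_lt_one
  nlinarith [h1.1, h1.2, h2.1, h2.2]

/-- The reserve 1 in `le_delta` dominates the next δv. Nested bounds put the sum β below each of
them, which is exactly u_n ≤ δ_n v_n. -/
theorem seqTop_antitone : Antitone (seqTop hpar) := by
  refine antitone_nat_of_succ_le fun n => ?_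
  have h1 := (seqStep hpar n).le_delta
  have h2 := (delta_mul_seqV_lt_one hpar (n + 1)).le
  have h3 := pow_pos inv_goldenRatio_pos (seqK hpar n)
  have h4 := pow_pos inv_goldenRatio_pos (seqStep hpar n).k
  rw [seqTop, seqTop, seqY_succ, seqK_succ, pow_add, add_assoc, mul_assoc, mul_assoc, ← mul_add]
  refine add_le_add le_rfl (mul_le_mul_of_nonneg_left (le_trans ?_ h1) h3.le)
  rw [← mul_add]
  exact mul_le_mul_of_nonneg_left (add_le_add le_rfl h2) h4.le

theorem seqY_le_seqTop (n m : ℕ) : seqY hpar n ≤ seqTop hpar m := by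
  have h : ∀ n, seqY hpar n ≤ seqTop hpar n := by
    intro n
    have h1 := pow_pos inv_goldenRatio_pos (seqK hpar n)
    have h2 := (hpar.delta_mem (n + 1) (by omega)).1
    have h3 := (seqV hpar n).2
    unfold seqTop
    exact le_add_of_nonneg_right (by positivity)
  calc seqY hpar n ≤ seqY hpar (max n m) := (seqY_strictMono hpar).monotone (le_max_left _ _)
    _ ≤ seqTop hpar (max n m) := h _
    _ ≤ seqTop hpar m := seqTop_antitone hpar (le_max_right _ _)

/-- The number `β`. -/
noncomputable def limBeta : ℝ := ⨆ n, seqY hpar n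

theorem seqY_lt_limBeta (n : ℕ) : seqY hpar n < limBeta hpar := by
  have hb : BddAbove (Set.range (seqY hpar)) :=
    ⟨seqTop hpar 0, by rintro _ ⟨m, rfl⟩; exact seqY_le_seqTop hpar m 0⟩
  exact (seqY_strictMono hpar n.lt_succ_self).trans_le (le_ciSup hb (n + 1))

theorem limBeta_le_seqTop (n : ℕ) : limBeta hpar ≤ seqTop hpar n :=
  ciSup_le fun m => seqY_le_seqTop hpar m n

/-- The number `u (n + 1)`. -/
noncomputable def seqU (n : ℕ) : ℝ := φ ^ seqK hpar n * (limBeta hpar - seqY hpar n)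

theorem goldenRatio_pow_mul_inv_pow (n : ℕ) : φ ^ n * φ⁻¹ ^ n = 1 := by
  rw [← mul_pow, mul_inv_cancel₀ Real.goldenRatio_ne_zero, one_pow]

theorem seqU_pos (n : ℕ) : 0 < seqU hpar n :=
  mul_pos (pow_pos Real.goldenRatio_pos _) (sub_pos.2 (seqY_lt_limBeta hpar n))

theorem seqU_le (n : ℕ) : seqU hpar n ≤ δ (n + 1) * seqV hpar n := by
  have h1 := limBeta_le_seqTop hpar n
  have h2 := pow_pos Real.goldenRatio_pos (seqK hpar n)
  have h3 : limBeta hpar - seqY hpar n ≤ φ⁻¹ ^ seqK hpar n * (δ (n + 1) * seqV hpar n) := by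
    rw [seqTop] at h1
    linarith
  calc seqU hpar n ≤ φ ^ seqK hpar n * (φ⁻¹ ^ seqK hpar n * (δ (n + 1) * seqV hpar n)) :=
        mul_le_mul_of_nonneg_left h3 h2.le
    _ = _ := by rw [← mul_assoc, goldenRatio_pow_mul_inv_pow, one_mul]

theorem seqU_succ (n : ℕ) : φ ^ (seqStep hpar n).k * seqU hpar n =
    normFactor * φ ^ ((seqStep hpar n).m + 1) + seqU hpar (n + 1) := by
  rw [seqU, seqU, seqY_succ, seqK_succ, pow_add, pow_add]
  linear_combination (φ ^ (seqStep hpar n).k * φ⁻¹ ^ (seqStep hpar n).k) *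
    (normFactor * φ ^ ((seqStep hpar n).m + 1)) * goldenRatio_pow_mul_inv_pow (seqK hpar n) +
    (normFactor * φ ^ ((seqStep hpar n).m + 1)) * goldenRatio_pow_mul_inv_pow (seqStep hpar n).k

theorem seqU_zero : seqU hpar 0 = limBeta hpar := by simp [seqU, seqK, seqY]

theorem pow_mulVec_combo {k : ℕ} (hk : Even k) (a b : ℝ) :
    (fibMatrix ℝ ^ k) *ᵥ (a • eU + b • eS) = (φ ^ k * a) • eU + (φ⁻¹ ^ k * b) • eS := by
  rw [eq_combo ((fibMatrix ℝ ^ k) *ᵥ (a • eU + b • eS)), coordU_pow_mulVec, coordS_pow_mulVec,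
    coordU_combo, coordS_combo, hk.neg_pow]

/-- Removing this lattice vector lowers the e_u-component by a large amount and raises the
e_s-component by a small positive one. -/
theorem pow_mulVec_single {m : ℕ} (hm : Even m) :
    (fibMatrix ℝ ^ m) *ᵥ (fun i => ((![1, 0] : Fin 2 → ℤ) i : ℝ)) =
      (normFactor * φ ^ (m + 1)) • eU + (-(normFactor * φ⁻¹ ^ m)) • eS := by
  rw [eq_combo (fun i => ((![1, 0] : Fin 2 → ℤ) i : ℝ)), pow_mulVec_combo hm]
  congr 2
  · simp [coordU]
    ring
  · simp [coordS]
    ring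

/-- Inductively, A^k sends the remainder to the next remainder plus A^m(1,0): φ^k u splits by
`seqU_succ`, and the negative e_s-component of A^m(1,0) is compensated in `StepData.next`. -/
theorem exists_int_seq (n : ℕ) : ∃ z : Fin 2 → ℤ,
    (fibMatrix ℝ ^ seqK hpar n) *ᵥ (limBeta hpar • eU + v₁ • eS) =
      (fun i => (z i : ℝ)) + (seqU hpar n • eU + (seqV hpar n : ℝ) • eS) := by
  induction n with
  | zero =>
    refine ⟨0, ?_⟩
    rw [seqU_zero]
    ext i
    simp [seqK, seqV]
  | succ n ih =>
    obtain ⟨z, hz⟩ := ih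
    obtain ⟨z', hz'⟩ := exists_int_pow_mulVec (seqStep hpar n).k z
    obtain ⟨z'', hz''⟩ := exists_int_pow_mulVec (seqStep hpar n).m ![1, 0]
    refine ⟨z' + z'', ?_⟩
    have h1 : (fun i => ((z' + z'') i : ℝ)) = (fun i => (z' i : ℝ)) + fun i => (z'' i : ℝ) := by
      ext i
      simp
    rw [seqK_succ, add_comm, pow_add, ← Matrix.mulVec_mulVec, hz, Matrix.mulVec_add, hz',
      pow_mulVec_combo (seqStep hpar n).even_k, seqU_succ, h1, ← hz'',
      pow_mulVec_single (seqStep hpar n).even_m, seqV_succ, StepData.next]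
    module

theorem even_seqK (n : ℕ) : Even (seqK hpar n) :=
  Finset.even_sum _ fun i _ => (seqStep hpar i).even_k

end Existence

end FibExample

/-! ### Admissibility, the number t, and assembly of the data -/

namespace FibExample

local notation "φ" => Real.goldenRatio

theorem fibMatrix_pow_pos (k : ℕ) (i j : Fin 2) : 0 < (fibMatrix ℕ ^ (k + 2)) i j := by
  induction k generalizing i j with
  | zero => fin_cases i <;> fin_cases j <;> simp [fibMatrix, pow_two]
  | succ k ih =>
    rw [show k + 1 + 2 = k + 2 + 1 by ring, pow_succ', Matrix.mul_apply, Fin.sum_univ_two]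
    have h0 := ih 0 j
    have h1 := ih 1 j
    generalize (fibMatrix ℕ ^ (k + 2)) 0 j = a at *
    generalize (fibMatrix ℕ ^ (k + 2)) 1 j = b at *
    fin_cases i <;> simp [fibMatrix] <;> omega

theorem one_le_normFactor_mul_sq : 1 ≤ normFactor * φ ^ 2 := by
  have h1 := normFactor_sq
  have h2 := Real.goldenRatio_sq
  have h3 := Real.one_lt_goldenRatio
  have h4 := normFactor_pos
  have h5 : 1 ^ 2 ≤ (normFactor * φ ^ 2) ^ 2 := by
    rw [mul_pow, one_pow, ← h1]
    refine mul_le_mul_of_nonneg_left ?_ (sq_nonneg _)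
    rw [h2]
    nlinarith
  exact (pow_le_pow_iff_left₀ zero_le_one (by positivity) two_ne_zero).1 h5

theorem inv_goldenRatio_pow_three_le : φ⁻¹ ^ 3 ≤ 1 / 4 := by
  have h1 := Real.goldenRatio_sq
  have h3 : 3 / 2 < φ := by
    have := Real.one_lt_goldenRatio
    nlinarith
  have h2 : (4 : ℝ) ≤ φ ^ 3 := by
    rw [pow_succ, h1]
    nlinarith
  rw [inv_pow, one_div]
  exact inv_anti₀ (by norm_num) h2

/-- The number `t` that belongs to `β`. -/
noncomputable def paramT (β : ℝ) : ℝ := (1 + normFactor * β * φ⁻¹) / (normFactor * φ ^ 2)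

/-- Equality of the two coordinates of (1,0) + βe_u + te_s reads cφ²t = 1 + cβφ⁻¹. -/
theorem paramT_eq (β : ℝ) :
    1 + β * (normFactor * φ) - paramT β * normFactor =
      β * normFactor + paramT β * (normFactor * φ) := by
  have h1 : paramT β * (normFactor * φ ^ 2) = 1 + normFactor * β * φ⁻¹ :=
    div_mul_cancel₀ _ (mul_pos normFactor_pos (pow_pos Real.goldenRatio_pos 2)).ne'
  rw [inv_goldenRatio_eq] at h1
  linear_combination -h1 + paramT β * normFactor * Real.goldenRatio_sq

/-- Since cφ < 1, already 1 / (cφ²) exceeds φ⁻¹. Through v₁ < ε₁ ≤ φ⁻¹ this yields t > v₁. -/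
theorem inv_goldenRatio_lt_paramT {β : ℝ} (h : 0 < β) : φ⁻¹ < paramT β := by
  have h1 := normFactor_mul_goldenRatio_lt_one
  have h2 := normFactor_pos
  have h3 := Real.goldenRatio_pos
  rw [paramT, lt_div_iff₀ (by positivity)]
  have h4 : φ⁻¹ * (normFactor * φ ^ 2) = normFactor * φ := by
    field_simp
  have h5 : 0 < normFactor * β * φ⁻¹ := by positivity
  linarith

theorem paramT_le_two {β : ℝ} (h : 0 < β) (h' : β < 1) : paramT β ≤ 2 := by
  have h1 := one_le_normFactor_mul_sq
  have h2 := normFactor_pos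
  have h3 := normFactor_lt_one
  have h4 := inv_goldenRatio_pos
  have h5 := inv_goldenRatio_lt_one
  rw [paramT, div_le_iff₀ (by linarith)]
  have : normFactor * β * φ⁻¹ ≤ 1 := by
    have : normFactor * β ≤ 1 := by nlinarith
    nlinarith
  linarith

/-- The condition on `w` and the rows `h` of `A ^ k` in terms of the components of `w`. -/
theorem bestAdmissible_of_lt {k : ℕ} (hk : 2 < k) (hke : Even k) {a b : ℝ} (ha : 0 < a)
    (hab : φ * a < b) (hlt : φ⁻¹ ^ k * b < φ * (φ ^ k * a)) (j : Fin 2) :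
    BestAdmissible (a • eU + b • eS) ((fibMatrix ℕ ^ k) j) := by
  have hφ := Real.goldenRatio_pos
  have hb : 0 < b := (mul_pos hφ ha).trans hab
  have hi := pow_pos inv_goldenRatio_pos k
  set x := a • eU + b • eS with hx
  have hU : coordU x = a := coordU_combo a b
  have hS : coordS x = b := coordS_combo a b
  have h0 : x 0 < 0 := by
    rw [zero_apply_eq x, hU, hS]
    exact mul_neg_of_pos_of_neg normFactor_pos (by linarith)
  have h1 : 0 < x 1 := by
    rw [one_apply_eq x, hU, hS]
    exact mul_pos normFactor_pos (by positivity)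
  -- With the signs of x known, the ratio condition is ⟨h, x⟩ > 0, a coordinate of A^k x. Only the
  -- coordinate 0 needs `hlt`.
  have hdot : 0 < ((fibMatrix ℝ ^ k) *ᵥ x) j := by
    have hU' := coordU_pow_mulVec k x
    have hS' := coordS_pow_mulVec k x
    rw [hU] at hU'
    rw [hS, hke.neg_pow] at hS'
    match j with
    | 0 =>
      rw [zero_apply_eq ((fibMatrix ℝ ^ k) *ᵥ x), hU', hS']
      exact mul_pos normFactor_pos (by linarith)
    | 1 =>
      rw [one_apply_eq ((fibMatrix ℝ ^ k) *ᵥ x), hU', hS']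
      exact mul_pos normFactor_pos (by positivity)
  rw [fibMatrix_pow_mulVec_apply] at hdot
  obtain ⟨l, rfl⟩ := Nat.exists_eq_add_of_le' hk.le
  refine ⟨h1.le, fun i => fibMatrix_pow_pos l j i, ?_⟩
  rw [abs_of_neg h0, abs_of_pos h1]
  linarith

section Existence

variable {ε δ : ℕ → ℝ} {v₁ : ℝ} (hpar : IsParameter ε δ v₁)

theorem limBeta_mem : limBeta hpar ∈ Set.Ioo (0 : ℝ) 1 := by
  rw [← seqU_zero]
  exact ⟨seqU_pos hpar 0, (seqU_le hpar 0).trans_lt (delta_mul_seqV_lt_one hpar 0)⟩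

theorem lt_paramT : v₁ < paramT (limBeta hpar) :=
  hpar.v_mem.2.trans_le ((hpar.eps_mem 1 le_rfl).2.trans
    (inv_goldenRatio_lt_paramT (limBeta_mem hpar).1).le)

/-- The exponents `k n`. -/
noncomputable def expK (n : ℕ) : ℕ := (seqStep hpar (n - 2)).k

theorem cumSum_expK (n : ℕ) : cumSum (expK hpar) (n + 1) = seqK hpar n := by
  induction n with
  | zero => simp [cumSum, seqK]
  | succ n ih => rw [cumSum_succ, ih, seqK_succ]; rfl

include hpar in
theorem nonempty_construction : Nonempty (Construction ε δ v₁) := by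
  choose z hz using exists_int_seq hpar
  exact ⟨{
    k := expK hpar
    β := limBeta hpar
    t := paramT (limBeta hpar)
    α := 1 + limBeta hpar * (normFactor * φ) - paramT (limBeta hpar) * normFactor
    -- The recursive sequences start at 0 and those of the construction at 1; the truncated value at
    -- 0 is never constrained.
    z n := z (n - 1)
    u n := seqU hpar (n - 1)
    v n := seqV hpar (n - 1)
    k_gt n _ := (seqStep hpar (n - 2)).k_gt
    k_eps n hn := by
      obtain ⟨n, rfl⟩ := Nat.exists_eq_add_of_le' hn
      exact (seqStep hpar n).k_eps
    β_mem := limBeta_mem hpar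
    v_one := rfl
    v_mem n hn := by
      obtain ⟨n, rfl⟩ := Nat.exists_eq_add_of_le' hn
      exact ⟨(seqV hpar n).2, seqV_lt hpar n⟩
    u_mem n hn := by
      obtain ⟨n, rfl⟩ := Nat.exists_eq_add_of_le' hn
      exact ⟨seqU_pos hpar n, seqU_le hpar n⟩
    decomp n hn s _ := by
      obtain ⟨n, rfl⟩ := Nat.exists_eq_add_of_le' hn
      have h1 := hz n
      have h2 : limBeta hpar • eU + s • eS =
          (limBeta hpar • eU + v₁ • eS) + ((0 : ℝ) • eU + (s - v₁) • eS) := by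
        module
      rw [cumSum_expK, h2, Matrix.mulVec_add, h1, pow_mulVec_combo (even_seqK hpar n), remainder,
        cumSum_expK, add_tsub_cancel_right]
      module
    t_gt := lt_paramT hpar
    α_eq := by
      ext i
      match i with
      | 0 =>
        change _ * (1 : ℝ) = 1 + _ * eU 0 + _ * eS 0
        rw [eU_zero, eS_zero]
        ring
      | 1 =>
        change _ * (1 : ℝ) = 0 + _ * eU 1 + _ * eS 1
        rw [eU_one, eS_one, mul_one, zero_add]
        exact paramT_eq _
    admissible n hn j := by
      obtain ⟨n, rfl⟩ := Nat.exists_eq_add_of_le' hn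
      have hφ := Real.one_lt_goldenRatio
      have hv := (seqV hpar n).2
      have hv' := (seqV_lt hpar n).trans_le (hpar.eps_mem (n + 1) (by omega)).2
      have hu := seqU_le hpar n
      have hδ := (hpar.delta_mem (n + 1) (by omega)).2
      have ht := lt_paramT hpar
      have ht' := paramT_le_two (limBeta_mem hpar).1 (limBeta_mem hpar).2
      have hi := pow_pos inv_goldenRatio_pos (seqK hpar n)
      have hi' := pow_le_one₀ (n := seqK hpar n) inv_goldenRatio_pos.le inv_goldenRatio_lt_one.le
      have hv₁ := hpar.v_mem.1
      have hk := (seqStep hpar n).k_gt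
      rw [remainder, cumSum_expK]
      refine bestAdmissible_of_lt hk (seqStep hpar n).even_k (seqU_pos hpar n) ?_ ?_ j
      · have h1 : φ * seqU hpar n ≤ seqV hpar n := by
          calc φ * seqU hpar n ≤ φ * (φ⁻¹ * seqV hpar n) := by
                refine mul_le_mul_of_nonneg_left (hu.trans ?_) (by linarith)
                exact mul_le_mul_of_nonneg_right hδ hv.le
            _ = _ := mul_inv_cancel_left₀ Real.goldenRatio_ne_zero _
        exact h1.trans_lt (lt_add_of_pos_right _ (mul_pos hi (sub_pos.2 ht)))
      · change φ⁻¹ ^ (seqStep hpar n).k * (seqV hpar n + _) <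
          φ * (φ ^ (seqStep hpar n).k * seqU hpar n)
        -- Here v < 1 and t - v₁ < 2. With k ≥ 3 the contracted e_s-component is at most 3/4, while
        -- φ times the expanded e_u-component exceeds cφ² ≥ 1.
        have h1 : (seqV hpar n : ℝ) + φ⁻¹ ^ seqK hpar n * (paramT (limBeta hpar) - v₁) < 3 := by
          have := inv_goldenRatio_lt_one
          nlinarith
        have h2 : φ⁻¹ ^ (seqStep hpar n).k ≤ 1 / 4 :=
          (pow_le_pow_of_le_one inv_goldenRatio_pos.le inv_goldenRatio_lt_one.le hk).trans
            inv_goldenRatio_pow_three_le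
        have h3 := pow_pos inv_goldenRatio_pos (seqStep hpar n).k
        have h4 := one_le_normFactor_mul_sq
        have h5 : normFactor * φ ^ 2 ≤ φ * (normFactor * φ ^ ((seqStep hpar n).m + 1)) := by
          have h6 : (1 : ℝ) ≤ φ ^ (seqStep hpar n).m := one_le_pow₀ hφ.le
          calc normFactor * φ ^ 2 ≤ normFactor * φ ^ 2 * φ ^ (seqStep hpar n).m :=
                le_mul_of_one_le_right (by linarith) h6
            _ = _ := by ring
        have h7 := mul_pos (show (0 : ℝ) < φ by linarith) (seqU_pos hpar (n + 1))
        have h8 : φ⁻¹ ^ (seqStep hpar n).k *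
            ((seqV hpar n : ℝ) + φ⁻¹ ^ seqK hpar n * (paramT (limBeta hpar) - v₁)) ≤
            φ⁻¹ ^ (seqStep hpar n).k * 3 := mul_le_mul_of_nonneg_left h1.le h3.le
        rw [seqU_succ, mul_add]
        linarith }⟩

end Existence

end FibExample

theorem mainTheorem7 (ε δ : ℕ → ℝ) (v₁ : ℝ) (hpar : FibExample.IsParameter ε δ v₁) :
    Nonempty (FibExample.Construction ε δ v₁) ∧
    ∀ D : FibExample.Construction ε δ v₁,
      D.diagram.IsBratteli ∧ D.diagram.IsProper ∧
      (∀ j, D.diagram.height 1 j = 1) ∧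
      (∀ n, D.diagram.incidence (n + 1) = FibExample.fibMatrix ℕ ^ D.k (n + 2)) ∧
      ∃ T : D.diagram.Path ≃ₜ D.diagram.Path,
        D.diagram.IsVershik T ∧
        IsCantorSpace D.diagram.Path ∧ IsMinimalHomeo T ∧ HasFiniteRank T 2 ∧
        IsUniquelyErgodic T ∧
        (∀ m : ℕ, ¬ ∃ (z : Fin 2 → ℤ) (s : Fin 2 → ℝ), s ∈ FibExample.stableSpace ∧
          (fun j : Fin 2 => D.α * (D.diagram.height (m + 1) j : ℝ)) =
            (fun j => (z j : ℝ)) + s) ∧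
        (∀ μ : MeasureTheory.Measure D.diagram.Path, MeasureTheory.IsProbabilityMeasure μ →
          MeasureTheory.MeasurePreserving T μ μ →
          IsMeasurableEigenvalue T μ (Complex.exp (2 * Real.pi * Complex.I * D.α))) ∧
        ¬ IsContinuousEigenvalue T (Complex.exp (2 * Real.pi * Complex.I * D.α)) := by
  refine ⟨FibExample.nonempty_construction hpar, fun D => ?_⟩
  have hB := D.isBratteli hpar
  have hP := D.isProper hpar
  have hne := D.nonempty_path hpar
  obtain ⟨vmin, vmax, hext⟩ := D.exists_hasExtremalSources hpar
  obtain ⟨T, hT⟩ := hext.exists_homeomorph hB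
  have hconn := D.connected hpar
  have hmin := hT.isMinimalHomeo hconn
  refine ⟨hB, hP, fun j => FibExample.height_one j, fun n => ?_, T, hT,
    OrderedDiagram.isCantorSpace_path hB hne hconn FibExample.nontrivial_vertex, hmin,
    ⟨D.diagram, hB, hP, FibExample.card_vertex_le, T, hT, Homeomorph.refl _, fun _ => rfl⟩,
    D.isUniquelyErgodic hpar hT, D.alpha_mul_height_not_mem hpar,
    fun μ _ hμ => D.isMeasurableEigenvalue hpar hT hμ, D.not_isContinuousEigenvalue hpar hT hmin⟩
  ext j i
  exact FibExample.incidence_vertex (D.bestPair hpar) n j i
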